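/- **Setting.** Let $\mathcal M$ be a finite-dimensional C*-algebra with a faithful tracial state $\psi$. Let $L^2(\mathcal M)$ be $\mathcal M$ with the inner product $\langle x,y\rangle=\psi(y^*x)$. Let $m:L^2(\mathcal M)\otimes L^2(\mathcal M)\to L^2(\mathcal M)$ be the multiplication, $m^*$ its Hilbert space adjoint, and $\eta:\mathbb C\to L^2(\mathcal M)$, $\lambda\mapsto\lambda 1$. Assume that $\psi$ is a $\delta$-form: $mm^*=\delta^2 I$ with $\delta>0$. Let $A$ be a self-adjoint operator on $L^2(\mathcal M)$ with $$m(A\otimes A)m^*=\delta^2A,\qquad (I\otimes\eta^*m)(I\otimes A\otimes I)(m^*\eta\otimes I)=A,\qquad m(A\otimes I)m^*=0,$$ and let $S\subseteq B(L^2(\mathcal M))$ be the range of $X\mapsto\delta^{-2}m(A\otimes X)m^*$. Then $\mathcal G=(\mathcal M,\psi,A,S)$ is called an irreflexive quantum graph. **Chromatic numbers.** Let $\mathcal M$ act on $L^2(\mathcal M)$ by left multiplication. A $c$-colouring of $\mathcal G$ consists of a nonzero finite-dimensional von Neumann algebra $\mathcal N$ with a faithful trace and of orthogonal projections $P_1,\dots,P_c\in\mathcal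 M\otimes\mathcal N$ with $\sum_aP_a=1$ and $P_a(X\otimes 1_{\mathcal N})P_a=0$ for all $X\in S$ and all $a$. The quantum chromatic number $\chi_q(\mathcal G)$ is the least $c$ for which a $c$-colouring exists, and the classical chromatic number $\chi(\mathcal G)$ is the least $c$ for which one with $\dim\mathcal N=1$ exists (each is $\infty$ if there is no such $c$). **Spectral data.** Let $D$ be the operator $x\mapsto x\,(A1)$ on $L^2(\mathcal M)$, and let $L=D-A$ and $Q=D+A$. Let $\lambda_{\max},\lambda_{\min}$ be the largest and smallest eigenvalues of $A$, let $\gamma_{\max},\gamma_{\min}$ be those of $Q$, and let $\theta_{\max}$ be the largest eigenvalue of $L$. Let $s^+$ and $s^-$ be the sums of the squares of the positive and of the negative eigenvalues of $A$, and let $n^+$ and $n^-$ be the numbers of positive and of negative eigenvalues of $A$, all counted with multiplicity. **Theorem.** If $S\neq 0$, then $|\lambda_{\min}|$, $\dim S-\dim\mathcal M\cdot\gamma_{\min}$, $s^+$, $s^-$, $n^+$, $n^-$ and $\lambda_{\max}-\gamma_{\max}+\theta_{\max}$ are positive. Moreover $$1+\max\left\{\frac{\lambda_{\max}}{|\lambda_{\min}|},\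 \frac{\dim S}{\dim S-\dim\mathcal M\cdot\gamma_{\min}},\ \frac{s^+}{s^-},\ \frac{s^-}{s^+},\ \frac{n^+}{n^-},\ \frac{n^-}{n^+},\ \frac{\lambda_{\max}}{\lambda_{\max}-\gamma_{\max}+\theta_{\max}}\right\}\le\chi_q(\mathcal G)\le\chi(\mathcal G),$$ where, if $S=0$, each of the quotients has the form $0/0$ and is read as $0$. -/

import Mathlib

open scoped TensorProduct ComplexOrder ENNReal

noncomputable section

/-- A faithful state on a unital C*-algebra. For finite-dimensional `M`, the pair `(M, ψ)` is a
quantum set. -/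
structure FaithfulState (M : Type*) [CStarAlgebra M] where
  /-- the underlying linear functional -/
  toFun : M →ₗ[ℂ] ℂ
  nonneg : ∀ x : M, 0 ≤ toFun (star x * x)
  faithful : ∀ x : M, toFun (star x * x) = 0 → x = 0
  map_one : toFun 1 = 1

namespace FaithfulState

/-- `ψ` is tracial: `ψ(xy) = ψ(yx)`. -/
def IsTracial {M : Type*} [CStarAlgebra M] (ψ : FaithfulState M) : Prop :=
  ∀ x y : M, ψ.toFun (x * y) = ψ.toFun (y * x)

theorem map_star {M : Type*} [CStarAlgebra M] (ψ : FaithfulState M) (x : M) :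
    ψ.toFun (star x) = starRingEnd ℂ (ψ.toFun x) := by
  have him : ∀ y : M, (ψ.toFun (star y * y)).im = 0 := fun y =>
    ((Complex.le_def.mp (ψ.nonneg y)).2).symm
  have h1 := him (x + 1)
  have h2 := him (x + Complex.I • (1 : M))
  have h0 := him x
  simp only [star_add, star_one, star_smul, add_mul, mul_add, one_mul, mul_one, map_add,
    smul_mul_assoc, mul_smul_comm, map_smul, smul_eq_mul, ψ.map_one, Complex.add_im,
    Complex.mul_im, Complex.one_im, RCLike.star_def, Complex.conj_I, Complex.neg_re,
    Complex.neg_im, Complex.I_re, Complex.I_im, h0] at h1 h2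
  apply Complex.ext
  · simp only [Complex.conj_re]; linarith
  · simp only [Complex.conj_im]; linarith

/-- The Hilbert space `L²(M, ψ)`: the vector space `M` with the inner product of `x` and `y`
given by `ψ(x* y)` (conjugate linear in `x`, Mathlib's convention). -/
def L2 {M : Type*} [CStarAlgebra M] (_ψ : FaithfulState M) : Type _ := M

instance {M : Type*} [CStarAlgebra M] (ψ : FaithfulState M) : AddCommGroup ψ.L2 :=
  inferInstanceAs (AddCommGroup M)

instance {M : Type*} [CStarAlgebra M] (ψ : FaithfulState M) : Module ℂ ψ.L2 :=
  inferInstanceAs (Module ℂ M)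

instance {M : Type*} [CStarAlgebra M] [FiniteDimensional ℂ M] (ψ : FaithfulState M) :
    FiniteDimensional ℂ ψ.L2 :=
  inferInstanceAs (FiniteDimensional ℂ M)

/-- The identity map `M → L²(M, ψ)`. -/
def toL2 {M : Type*} [CStarAlgebra M] (ψ : FaithfulState M) : M ≃ₗ[ℂ] ψ.L2 :=
  LinearEquiv.refl ℂ M

/-- The inner product of `L²(M, ψ)`. -/
@[reducible]
def innerCore {M : Type*} [CStarAlgebra M] (ψ : FaithfulState M) :
    InnerProductSpace.Core ℂ ψ.L2 where
  inner x y := ψ.toFun (star (ψ.toL2.symm x) * ψ.toL2.symm y)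
  conj_inner_symm x y := by simp [← ψ.map_star]
  re_inner_nonneg x := (Complex.le_def.mp (ψ.nonneg (ψ.toL2.symm x))).1
  add_left x y z := by simp [add_mul]
  smul_left x y r := by simp
  definite x h := by simpa using ψ.faithful _ h

instance {M : Type*} [CStarAlgebra M] (ψ : FaithfulState M) : NormedAddCommGroup ψ.L2 :=
  ψ.innerCore.toNormedAddCommGroup

instance {M : Type*} [CStarAlgebra M] (ψ : FaithfulState M) : InnerProductSpace ℂ ψ.L2 :=
  InnerProductSpace.ofCore ψ.innerCore.toCore

theorem inner_def {M : Type*} [CStarAlgebra M] (ψ : FaithfulState M) (x y : M) :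
    inner ℂ (ψ.toL2 x) (ψ.toL2 y) = ψ.toFun (star x * y) := rfl

/-- The left regular representation `M → B(L²(M))`. -/
def leftReg {M : Type*} [CStarAlgebra M] (ψ : FaithfulState M) : M →ₐ[ℂ] Module.End ℂ ψ.L2 :=
  (ψ.toL2.conjAlgEquiv ℂ).toAlgHom.comp (Algebra.lmul ℂ M)

/-- Right multiplication by `a`, as an operator on `L²(M)`. -/
def rightMul {M : Type*} [CStarAlgebra M] (ψ : FaithfulState M) (a : M) : Module.End ℂ ψ.L2 :=
  ψ.toL2.conj (LinearMap.mulRight ℂ a)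

/-- The multiplication `m : L²(M) ⊗ L²(M) → L²(M)`. -/
def mulMap {M : Type*} [CStarAlgebra M] (ψ : FaithfulState M) :
    ψ.L2 ⊗[ℂ] ψ.L2 →ₗ[ℂ] ψ.L2 :=
  ψ.toL2.toLinearMap ∘ₗ LinearMap.mul' ℂ M ∘ₗ
    TensorProduct.map ψ.toL2.symm.toLinearMap ψ.toL2.symm.toLinearMap

/-- The unit map `η : ℂ → L²(M)`. -/
def unitMap {M : Type*} [CStarAlgebra M] (ψ : FaithfulState M) : ℂ →ₗ[ℂ] ψ.L2 :=
  LinearMap.toSpanSingleton ℂ ψ.L2 (ψ.toL2 1)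

variable {M : Type*} [CStarAlgebra M] [FiniteDimensional ℂ M]

/-- The comultiplication `m* : L²(M) → L²(M) ⊗ L²(M)`, the Hilbert space adjoint of `m`. -/
def comulMap (ψ : FaithfulState M) : ψ.L2 →ₗ[ℂ] ψ.L2 ⊗[ℂ] ψ.L2 :=
  LinearMap.adjoint ψ.mulMap

/-- `ψ` is a `δ`-form: `δ > 0` and `m m* = δ² I`. -/
def IsDeltaForm (ψ : FaithfulState M) (δ : ℝ) : Prop :=
  0 < δ ∧ ψ.mulMap ∘ₗ ψ.comulMap = ((δ : ℂ) ^ 2) • LinearMap.id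

/-- The operator `m (X ⊗ Y) m*`; up to the factor `δ⁻²` this is the quantum Schur product. -/
def schur (ψ : FaithfulState M) (X Y : Module.End ℂ ψ.L2) : Module.End ℂ ψ.L2 :=
  ψ.mulMap ∘ₗ TensorProduct.map X Y ∘ₗ ψ.comulMap

/-- `(I ⊗ η*m) (I ⊗ A ⊗ I) (m*η ⊗ I)`. -/
def flipAdj (ψ : FaithfulState M) (A : Module.End ℂ ψ.L2) : Module.End ℂ ψ.L2 :=
  (TensorProduct.rid ℂ ψ.L2).toLinearMap ∘ₗ
    LinearMap.lTensor ψ.L2 (LinearMap.adjoint ψ.unitMap ∘ₗ ψ.mulMap) ∘ₗ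
    LinearMap.lTensor ψ.L2 (LinearMap.rTensor ψ.L2 A) ∘ₗ
    (TensorProduct.assoc ℂ ψ.L2 ψ.L2 ψ.L2).toLinearMap ∘ₗ
    LinearMap.rTensor ψ.L2 (ψ.comulMap ∘ₗ ψ.unitMap) ∘ₗ
    (TensorProduct.lid ℂ ψ.L2).symm.toLinearMap

/-- `A` is a self-adjoint quantum adjacency matrix on `(M, ψ)`, i.e. `(M, ψ, A)` is an
(undirected) quantum graph. -/
structure IsQuantumAdjacency (ψ : FaithfulState M) (δ : ℝ) (A : Module.End ℂ ψ.L2) : Prop where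
  selfAdjoint : A.IsSymmetric
  schur_self : ψ.schur A A = ((δ : ℂ) ^ 2) • A
  flip_self : ψ.flipAdj A = A

/-- The quantum graph `(M, ψ, A)` is irreflexive. -/
def IsIrreflexive (ψ : FaithfulState M) (A : Module.End ℂ ψ.L2) : Prop :=
  ψ.schur A LinearMap.id = 0

/-- The map `P(X) = δ⁻² m (A ⊗ X) m*` on `B(L²(M))`. -/
def edgeProj (ψ : FaithfulState M) (δ : ℝ) (A : Module.End ℂ ψ.L2) :
    Module.End ℂ ψ.L2 →ₗ[ℂ] Module.End ℂ ψ.L2 where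
  toFun X := ((δ : ℂ) ^ 2)⁻¹ • ψ.schur A X
  map_add' X Y := by
    simp [schur, TensorProduct.map_add_right, LinearMap.comp_add, LinearMap.add_comp]
  map_smul' r X := by
    simp [schur, TensorProduct.map_smul_right, LinearMap.comp_smul, LinearMap.smul_comp,
      smul_comm r]

/-- The operator space `S ⊆ B(L²(M))` of the quantum graph `(M, ψ, A)`: the range of
`X ↦ δ⁻² m (A ⊗ X) m*`. -/
def edgeSpace (ψ : FaithfulState M) (δ : ℝ) (A : Module.End ℂ ψ.L2) :
    Submodule ℂ (Module.End ℂ ψ.L2) :=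
  LinearMap.range (ψ.edgeProj δ A)

/-- The quantum degree matrix: right multiplication by `A 1`. -/
def degree (ψ : FaithfulState M) (A : Module.End ℂ ψ.L2) : Module.End ℂ ψ.L2 :=
  ψ.rightMul (ψ.toL2.symm (A (ψ.toL2 1)))

/-- The quantum Laplacian `L = D - A`. -/
def laplacian (ψ : FaithfulState M) (A : Module.End ℂ ψ.L2) : Module.End ℂ ψ.L2 :=
  ψ.degree A - A

/-- The quantum signless Laplacian `Q = D + A`. -/
def signlessLaplacian (ψ : FaithfulState M) (A : Module.End ℂ ψ.L2) : Module.End ℂ ψ.L2 :=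
  ψ.degree A + A

/-- The projections `P 1, …, P c` in `M ⊗ N` form a colouring of the operator space `S`: they sum
to `1` and `P_a (X ⊗ 1) P_a = 0` in `B(L²(M)) ⊗ N` for all `X ∈ S`, where `M` acts on `L²(M)` by
left multiplication. -/
structure IsColoring (ψ : FaithfulState M) (S : Submodule ℂ (Module.End ℂ ψ.L2))
    (N : Type*) [CStarAlgebra N] {c : ℕ} (P : Fin c → M ⊗[ℂ] N) : Prop where
  proj : ∀ a, IsStarProjection (P a)
  sum_eq_one : ∑ a, P a = 1
  annihilate : ∀ X ∈ S, ∀ a,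
    Algebra.TensorProduct.map ψ.leftReg (AlgHom.id ℂ N) (P a) * (X ⊗ₜ[ℂ] (1 : N)) *
      Algebra.TensorProduct.map ψ.leftReg (AlgHom.id ℂ N) (P a) = 0

/-- There is a quantum `c`-colouring: `N` is a finite-dimensional von Neumann algebra (that is, a
finite-dimensional C*-algebra) with a faithful trace `τ`, normalized by `τ 1 = 1`. Normality of `τ`
is automatic, and every such algebra is isomorphic to one in the lowest universe. -/
def QuantumColorable (ψ : FaithfulState M) (S : Submodule ℂ (Module.End ℂ ψ.L2)) (c : ℕ) : Prop :=
  ∃ (N : Type) (_ : CStarAlgebra N) (τ : FaithfulState N) (P : Fin c → M ⊗[ℂ] N),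
    FiniteDimensional ℂ N ∧ τ.IsTracial ∧ ψ.IsColoring S N P

/-- There is a classical `c`-colouring: a colouring with `dim N = 1`. -/
def ClassicalColorable (ψ : FaithfulState M) (S : Submodule ℂ (Module.End ℂ ψ.L2)) (c : ℕ) :
    Prop :=
  ∃ (N : Type) (_ : CStarAlgebra N) (τ : FaithfulState N) (P : Fin c → M ⊗[ℂ] N),
    Module.finrank ℂ N = 1 ∧ τ.IsTracial ∧ ψ.IsColoring S N P

/-- The quantum chromatic number: the least `c` with a quantum `c`-colouring (`⊤` if none). -/
def quantumChromaticNumber (ψ : FaithfulState M) (S : Submodule ℂ (Module.End ℂ ψ.L2)) : ℕ∞ :=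
  ⨅ c ∈ {c : ℕ | ψ.QuantumColorable S c}, (c : ℕ∞)

/-- The classical chromatic number: the least `c` with a classical `c`-colouring (`⊤` if none). -/
def classicalChromaticNumber (ψ : FaithfulState M) (S : Submodule ℂ (Module.End ℂ ψ.L2)) : ℕ∞ :=
  ⨅ c ∈ {c : ℕ | ψ.ClassicalColorable S c}, (c : ℕ∞)

end FaithfulState

section Spectral

variable {E : Type*} [NormedAddCommGroup E] [InnerProductSpace ℂ E] [FiniteDimensional ℂ E]

/-- The largest real eigenvalue; for a self-adjoint operator on a nonzero finite-dimensional space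
the set is finite and nonempty. -/
def maxEigenvalue (T : Module.End ℂ E) : ℝ := sSup {r : ℝ | T.HasEigenvalue (r : ℂ)}

/-- The smallest real eigenvalue. -/
def minEigenvalue (T : Module.End ℂ E) : ℝ := sInf {r : ℝ | T.HasEigenvalue (r : ℂ)}

/-- The sum of the squares of the positive eigenvalues, with multiplicity. -/
def sqSumPos {T : Module.End ℂ E} (hT : T.IsSymmetric) : ℝ :=
  ∑ i with 0 < hT.eigenvalues rfl i, hT.eigenvalues rfl i ^ 2

/-- The sum of the squares of the negative eigenvalues, with multiplicity. -/
def sqSumNeg {T : Module.End ℂ E} (hT : T.IsSymmetric) : ℝ :=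
  ∑ i with hT.eigenvalues rfl i < 0, hT.eigenvalues rfl i ^ 2

/-- The number of positive eigenvalues, with multiplicity. -/
def numPos {T : Module.End ℂ E} (hT : T.IsSymmetric) : ℕ :=
  Finset.card {i | 0 < hT.eigenvalues rfl i}

/-- The number of negative eigenvalues, with multiplicity. -/
def numNeg {T : Module.End ℂ E} (hT : T.IsSymmetric) : ℕ :=
  Finset.card {i | hT.eigenvalues rfl i < 0}

end Spectral

end

/-! A colouring with `c = n + 1` classes, represented on `L²(M) ⊗ L²(N)`, is a resolution of the
identity by projections `P a` whose pinching `X ↦ ∑ P a X P a` kills `A ⊗ 1`. With `U = ∑ ω ^ a P a`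
and `ω` a primitive `c`-th root of unity, the pinching is the average of the conjugations by `U ^
k`, `0 ≤ k < c` (`sum_clockUnitary_conj`). The term `k = 0` is `A ⊗ 1` itself, so the other `n`
conjugates add up to `-(A ⊗ 1)`. The degree matrix is a right multiplication, hence commutes with
the `P a`, which come from left multiplications, and each conjugation fixes it.

Five of the seven bounds use only these two facts. Testing the extreme eigenvalues of `A`, `D + A`
or `D - A` on the vectors `(U ^ k)* v` gives the `λ` bound (`v` a top eigenvector of `A`), the `dim
S` bound (`v = 1`, where `A` and `D` both have expectation `ψ(A 1) = dim S / dim M`) and the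
signless bound (`v` a top eigenvector of `Q`). A dimension count gives the two inertia bounds. The
two bounds on sums of squares compare the positive and negative parts of `A`, which have the same
pinching (`sum_sq_pos_le_of_pinching`).

The denominators are positive because irreflexivity makes `A` traceless, so a nonzero `A` has
eigenvalues of both signs; the two denominators that involve `Q` need separate arguments. For the
last one, irreflexivity says that `∑ e_i A e_i* = 0` for left multiplications by an orthonormal
basis of `L²(M)`. These operators, with `e = 1` removed, take the place of the powers of `U` in the
same signless inequality. -/

noncomputable section

/-! ### Pinchings as averages over powers of a clock unitary. -/

section Twirl

variable {R : Type*} [Ring R] [Algebra ℂ R] {c : ℕ}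

/-- The unitary `∑ a, ω ^ (k a) P a`, where `ω` is the standard primitive `c`-th root of unity. -/
def clockUnitary (P : Fin c → R) (k : ℕ) : R :=
  ∑ a : Fin c, (Complex.exp (2 * Real.pi * Complex.I / c) ^ (a : ℕ)) ^ k • P a

theorem clockUnitary_zero {P : Fin c → R} (hsum : ∑ a, P a = 1) : clockUnitary P 0 = 1 := by
  simp [clockUnitary, hsum]

theorem commute_clockUnitary {P : Fin c → R} {Y : R} (h : ∀ a, Commute (P a) Y) (k : ℕ) :
    Commute (clockUnitary P k) Y :=
  Commute.sum_left _ _ _ fun a _ => (h a).smul_left _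

variable [StarRing R] [StarModule ℂ R]

theorem conj_rootOfUnity_mul (c : ℕ) :
    Complex.exp (2 * Real.pi * Complex.I / c) *
      star (Complex.exp (2 * Real.pi * Complex.I / c)) = 1 := by
  rw [RCLike.star_def, ← Complex.exp_conj, ← Complex.exp_add]
  rw [map_div₀, map_mul, map_mul, Complex.conj_I, Complex.conj_ofReal, Complex.conj_ofNat,
    Complex.conj_natCast, mul_neg, neg_div, add_neg_cancel, Complex.exp_zero]

theorem star_clockUnitary {P : Fin c → R} (hP : ∀ a, IsStarProjection (P a)) (k : ℕ) :
    star (clockUnitary P k) =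
      ∑ a : Fin c, (star (Complex.exp (2 * Real.pi * Complex.I / c)) ^ (a : ℕ)) ^ k • P a := by
  simp only [clockUnitary, star_sum, star_smul, star_pow]
  refine Finset.sum_congr rfl fun a _ => ?_
  rw [(hP a).isSelfAdjoint.star_eq]

theorem clockUnitary_conj (P : Fin c → R) (hP : ∀ a, IsStarProjection (P a)) (X : R) (k : ℕ) :
    clockUnitary P k * X * star (clockUnitary P k) =
      ∑ a : Fin c, ∑ b : Fin c, ((Complex.exp (2 * Real.pi * Complex.I / c) ^ (a : ℕ)) *
        star (Complex.exp (2 * Real.pi * Complex.I / c)) ^ (b : ℕ)) ^ k • (P a * X * P b) := by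
  rw [star_clockUnitary hP, clockUnitary, Finset.sum_mul, Finset.sum_mul]
  refine Finset.sum_congr rfl fun a _ => ?_
  rw [Finset.mul_sum]
  refine Finset.sum_congr rfl fun b _ => ?_
  rw [mul_pow, smul_mul_assoc, smul_mul_assoc, mul_smul_comm, smul_smul]

theorem clockUnitary_mul_star {P : Fin c → R} (hP : ∀ a, IsStarProjection (P a))
    (horth : ∀ a b, a ≠ b → P a * P b = 0) (hsum : ∑ a, P a = 1) (k : ℕ) :
    clockUnitary P k * star (clockUnitary P k) = 1 := by
  have h := clockUnitary_conj P hP 1 k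
  rw [mul_one] at h
  rw [h]
  refine Eq.trans (Finset.sum_congr rfl fun a _ => ?_) hsum
  rw [Finset.sum_eq_single a]
  · rw [← mul_pow, conj_rootOfUnity_mul, one_pow, one_pow, one_smul, mul_one,
      (hP a).isIdempotentElem.eq]
  · intro b _ hb
    rw [mul_one, horth a b hb.symm, smul_zero]
  · simp

/-- The base of the powers is `ω ^ (a - b)`, a `c`-th root of unity other than `1`, so its geometric
sum vanishes. -/
theorem rootOfUnity_sum (a b : Fin c) (hab : a ≠ b) :
    ∑ k ∈ Finset.range c, ((Complex.exp (2 * Real.pi * Complex.I / c) ^ (a : ℕ)) *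
        star (Complex.exp (2 * Real.pi * Complex.I / c)) ^ (b : ℕ)) ^ k = 0 := by
  have hc : c ≠ 0 := by rintro rfl; exact a.elim0
  have hω := Complex.isPrimitiveRoot_exp c hc
  have hω' := conj_rootOfUnity_mul c
  set ω := Complex.exp (2 * Real.pi * Complex.I / c)
  set z := ω ^ (a : ℕ) * star ω ^ (b : ℕ) with hz
  have hzb : z * ω ^ (b : ℕ) = ω ^ (a : ℕ) := by
    rw [hz, mul_assoc, ← mul_pow, mul_comm (star ω), hω', one_pow, mul_one]
  have hz1 : z ≠ 1 := by
    intro h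
    rw [h, one_mul] at hzb
    exact hab (Fin.ext (hω.pow_inj a.2 b.2 hzb.symm))
  have hzc : z ^ c = 1 := by
    rw [hz, mul_pow, ← pow_mul, ← pow_mul, mul_comm (a : ℕ), mul_comm (b : ℕ), pow_mul, pow_mul,
      ← star_pow, hω.pow_eq_one]
    simp
  have h := mul_neg_geom_sum z c
  rw [hzc, sub_self] at h
  exact (mul_eq_zero.mp h).resolve_left (sub_ne_zero_of_ne hz1.symm)

/-- The block `P a * X * P b` is weighted by the sum over `k` of `ω ^ (k (a - b))`, which is `c` on
the diagonal and `0` off it. -/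
theorem sum_clockUnitary_conj {P : Fin c → R} (hP : ∀ a, IsStarProjection (P a)) (X : R) :
    ∑ k ∈ Finset.range c, clockUnitary P k * X * star (clockUnitary P k) =
      (c : ℂ) • ∑ a, P a * X * P a := by
  simp only [clockUnitary_conj P hP]
  rw [Finset.sum_comm, Finset.smul_sum]
  refine Finset.sum_congr rfl fun a _ => ?_
  rw [Finset.sum_comm, Finset.sum_eq_single a]
  · rw [← Finset.sum_smul]
    congr 1
    simp only [← mul_pow, conj_rootOfUnity_mul, one_pow, Finset.sum_const, Finset.card_range,
      nsmul_eq_mul, mul_one]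
  · intro b _ hb
    rw [← Finset.sum_smul, rootOfUnity_sum a b hb.symm, zero_smul]
  · simp

end Twirl

/-! ### Quadratic form inequalities from `∑ V_k X V_k* = -X`. -/

section QuadraticForm

variable {F : Type*} [NormedAddCommGroup F] [InnerProductSpace ℂ F]

/-- The eigenbasis is data over an arbitrary index type, so that `A ⊗ 1` and `-(A ⊗ 1)` can be used
with the eigenvalues of `A` indexed by pairs. -/
theorem re_inner_apply_eq_sum {ι : Type*} [Fintype ι] (b : OrthonormalBasis ι ℂ F)
    {X : Module.End ℂ F} {μ : ι → ℝ} (hX : ∀ i, X (b i) = (μ i : ℂ) • b i) (v : F) :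
    (inner ℂ v (X v)).re = ∑ i, μ i * ‖inner ℂ (b i) v‖ ^ 2 := by
  have h : X v = ∑ i, (inner ℂ (b i) v * μ i) • b i := by
    conv_lhs => rw [← b.sum_repr' v]
    simp [hX, ← smul_smul]
  rw [h, inner_sum, Complex.re_sum]
  refine Finset.sum_congr rfl fun i _ => ?_
  rw [inner_smul_right, ← inner_conj_symm v (b i), mul_right_comm, RCLike.mul_conj]
  rw [mul_comm, Complex.re_ofReal_mul]
  congr 1
  norm_cast

theorem re_inner_apply_le {ι : Type*} [Fintype ι] (b : OrthonormalBasis ι ℂ F)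
    {X : Module.End ℂ F} {μ : ι → ℝ} (hX : ∀ i, X (b i) = (μ i : ℂ) • b i) {r : ℝ}
    (hr : ∀ i, μ i ≤ r) (v : F) : (inner ℂ v (X v)).re ≤ r * ‖v‖ ^ 2 := by
  rw [re_inner_apply_eq_sum b hX, ← b.sum_sq_norm_inner_right v, Finset.mul_sum]
  exact Finset.sum_le_sum fun i _ => mul_le_mul_of_nonneg_right (hr i) (sq_nonneg _)

theorem le_re_inner_apply {ι : Type*} [Fintype ι] (b : OrthonormalBasis ι ℂ F)
    {X : Module.End ℂ F} {μ : ι → ℝ} (hX : ∀ i, X (b i) = (μ i : ℂ) • b i) {r : ℝ}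
    (hr : ∀ i, r ≤ μ i) (v : F) : r * ‖v‖ ^ 2 ≤ (inner ℂ v (X v)).re := by
  rw [re_inner_apply_eq_sum b hX, ← b.sum_sq_norm_inner_right v, Finset.mul_sum]
  exact Finset.sum_le_sum fun i _ => mul_le_mul_of_nonneg_right (hr i) (sq_nonneg _)

variable [FiniteDimensional ℂ F]

theorem inner_conj_apply (V X : Module.End ℂ F) (v : F) :
    inner ℂ v ((V * X * star V) v) = inner ℂ (star V v) (X (star V v)) := by
  rw [LinearMap.star_eq_adjoint, LinearMap.adjoint_inner_left]
  rfl

theorem sum_inner_conj {κ : Type*} (s : Finset κ) (V : κ → Module.End ℂ F) {X Y : Module.End ℂ F}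
    (h : ∑ k ∈ s, V k * X * star (V k) = Y) (v : F) :
    ∑ k ∈ s, (inner ℂ (star (V k) v) (X (star (V k) v))).re = (inner ℂ v (Y v)).re := by
  simp only [← inner_conj_apply, ← h, LinearMap.sum_apply, inner_sum, Complex.re_sum]

theorem sum_norm_sq_conj {κ : Type*} (s : Finset κ) (V : κ → Module.End ℂ F) {r : ℝ}
    (h : ∑ k ∈ s, V k * star (V k) = (r : ℂ) • 1) (v : F) :
    ∑ k ∈ s, ‖star (V k) v‖ ^ 2 = r * ‖v‖ ^ 2 := by
  have h' := sum_inner_conj s V (X := 1) (Y := (r : ℂ) • 1) (by simpa using h) v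
  simp only [Module.End.one_apply, LinearMap.smul_apply, inner_smul_right,
    inner_self_eq_norm_sq_to_K] at h'
  simpa only [← Complex.ofReal_pow, ← Complex.ofReal_mul, Complex.ofReal_re,
    Complex.coe_algebraMap, RCLike.ofReal_alg, Complex.real_smul, mul_one] using h'

/-- For `w` in the range of `P b`, the numbers `‖P a w‖²` add up to `‖w‖²`, and the term of `b`
alone exhausts this sum. -/
theorem orthogonal_of_sum_eq_one {c : ℕ} {P : Fin c → Module.End ℂ F}
    (hP : ∀ a, IsStarProjection (P a)) (hsum : ∑ a, P a = 1) (a b : Fin c) (hab : a ≠ b) :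
    P a * P b = 0 := by
  have hq : ∀ (a : Fin c) (w : F), (inner ℂ w (P a w)).re = ‖P a w‖ ^ 2 := by
    intro a w
    have h := inner_conj_apply (P a) 1 w
    rw [(hP a).isSelfAdjoint.star_eq, mul_one, (hP a).isIdempotentElem.eq, Module.End.one_apply,
      inner_self_eq_norm_sq_to_K] at h
    rw [h]
    norm_cast
  ext v
  set w := P b v with hw
  have hbw : P b w = w := by
    rw [hw, ← Module.End.mul_apply, (hP b).isIdempotentElem.eq]
  have h1 : ∑ a, ‖P a w‖ ^ 2 = ‖w‖ ^ 2 := by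
    simp only [← hq, ← Complex.re_sum, ← inner_sum, ← LinearMap.sum_apply, hsum,
      Module.End.one_apply, inner_self_eq_norm_sq_to_K]
    norm_cast
  have h2 : ‖P a w‖ ^ 2 + ‖P b w‖ ^ 2 ≤ ∑ a, ‖P a w‖ ^ 2 := by
    rw [← Finset.sum_pair (f := fun a => ‖P a w‖ ^ 2) hab]
    exact Finset.sum_le_sum_of_subset_of_nonneg (Finset.subset_univ _) fun _ _ _ => sq_nonneg _
  rw [hbw, h1] at h2
  have h3 : ‖P a w‖ = 0 := by nlinarith [norm_nonneg (P a w)]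
  simpa [← hw] using h3

/-- Otherwise the positive spectral subspace has dimension larger than `n` times the number of
negative eigenvalues. It then contains a nonzero vector `p x` such that every `V_k* (p x)` is
orthogonal to all negative eigenvectors. The form of `X` is nonnegative at each `V_k* (p x)`, yet
these values add up to minus the positive value at `p x`. -/
theorem card_pos_le_of_sum_conj_eq_neg {ι : Type*} [Fintype ι] (b : OrthonormalBasis ι ℂ F)
    {X : Module.End ℂ F} {μ : ι → ℝ} (hX : ∀ i, X (b i) = (μ i : ℂ) • b i) {n : ℕ}
    (V : ℕ → Module.End ℂ F) (hV : ∑ k ∈ Finset.range n, V k * X * star (V k) = -X) :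
    Finset.card {i | 0 < μ i} ≤ n * Finset.card {i | μ i < 0} := by
  classical
  by_contra! hlt
  let p : ({i // 0 < μ i} → ℂ) →ₗ[ℂ] F := Fintype.linearCombination ℂ fun i => b i.1
  let T : ({i // 0 < μ i} → ℂ) →ₗ[ℂ] (Fin n × {i // μ i < 0} → ℂ) :=
    LinearMap.pi fun kj => (innerₛₗ ℂ (b kj.2.1)) ∘ₗ star (V kj.1) ∘ₗ p
  have hker : LinearMap.ker T ≠ ⊥ := by
    apply LinearMap.ker_ne_bot_of_finrank_lt
    simpa [Fintype.card_subtype] using hlt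
  obtain ⟨x, hx, hx0⟩ := Submodule.exists_mem_ne_zero_of_ne_bot hker
  have hTx : ∀ k : Fin n, ∀ j : {i // μ i < 0}, inner ℂ (b j.1) (star (V k) (p x)) = 0 :=
    fun k j => congrFun (LinearMap.mem_ker.mp hx) (k, j)
  have hp : ∀ i, inner ℂ (b i) (p x) = if h : 0 < μ i then x ⟨i, h⟩ else 0 := by
    intro i
    simp only [p, Fintype.linearCombination_apply, inner_sum, inner_smul_right,
      b.inner_eq_ite, mul_ite, mul_one, mul_zero]
    split_ifs with h
    · rw [Finset.sum_eq_single ⟨i, h⟩]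
      · simp
      · intro j _ hj
        rw [if_neg]
        rintro rfl
        exact hj rfl
      · simp
    · refine Finset.sum_eq_zero fun j _ => if_neg ?_
      rintro rfl
      exact h j.2
  have hpos : 0 < (inner ℂ (p x) (X (p x))).re := by
    rw [re_inner_apply_eq_sum b hX]
    obtain ⟨i, hi⟩ := Function.ne_iff.mp hx0
    refine Finset.sum_pos' (fun j _ => ?_) ⟨i.1, Finset.mem_univ _, ?_⟩
    · rw [hp]
      split_ifs with h
      · positivity
      · simp
    · rw [hp, dif_pos i.2]
      have : 0 < ‖x i‖ := norm_pos_iff.mpr hi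
      have := i.2
      positivity
  have hneg := sum_inner_conj _ V hV (p x)
  have hnn : 0 ≤ ∑ k ∈ Finset.range n,
      (inner ℂ (star (V k) (p x)) (X (star (V k) (p x)))).re := by
    refine Finset.sum_nonneg fun k hk => ?_
    rw [re_inner_apply_eq_sum b hX]
    refine Finset.sum_nonneg fun j _ => ?_
    by_cases hj : μ j < 0
    · simp [hTx ⟨k, Finset.mem_range.mp hk⟩ ⟨j, hj⟩]
    · exact mul_nonneg (not_lt.mp hj) (sq_nonneg _)
  rw [hneg, LinearMap.neg_apply, inner_neg_right, Complex.neg_re] at hnn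
  linarith

/-- The inequality behind the bound of Kolotilina type. -/
theorem signless_le_of_sum_conj_eq_neg {κ : Type*} (s : Finset κ) (V : κ → Module.End ℂ F)
    {X D : Module.End ℂ F} {r θ l γ : ℝ} (hr : 1 ≤ r)
    (h1 : ∑ k ∈ s, V k * star (V k) = (r : ℂ) • 1)
    (hX : ∑ k ∈ s, V k * X * star (V k) = -X)
    (hD : ∑ k ∈ s, V k * D * star (V k) = (r : ℂ) • D)
    (hθ : ∀ w, (inner ℂ w ((D - X) w)).re ≤ θ * ‖w‖ ^ 2)
    (hl : ∀ w, (inner ℂ w (X w)).re ≤ l * ‖w‖ ^ 2)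
    {v : F} (hv : ‖v‖ = 1) (hγ : (inner ℂ v ((D + X) v)).re = γ) :
    r * γ ≤ r * θ + (r - 1) * l := by
  have e1 := sum_norm_sq_conj s V h1 v
  have e2 := sum_inner_conj s V hX v
  have e3 := sum_inner_conj s V hD v
  have e4 : ∑ k ∈ s, (inner ℂ (star (V k) v) ((D - X) (star (V k) v))).re ≤
      ∑ k ∈ s, θ * ‖star (V k) v‖ ^ 2 := Finset.sum_le_sum fun k _ => hθ _
  simp only [LinearMap.sub_apply, LinearMap.add_apply, inner_sub_right, inner_add_right,
    Complex.sub_re, Complex.add_re, Finset.sum_sub_distrib, ← Finset.mul_sum, e1, e2, e3,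
    LinearMap.neg_apply, LinearMap.smul_apply, inner_neg_right, inner_smul_right, Complex.neg_re,
    Complex.re_ofReal_mul, hv] at e4 hγ
  have e5 := hl v
  rw [hv] at e5
  -- The summed inequality is `r⟨v, D v⟩ + ⟨v, X v⟩ ≤ r θ`. Replacing `⟨v, D v⟩` by `γ - ⟨v, X v⟩`
  -- leaves `r γ ≤ r θ + (r - 1)⟨v, X v⟩`, and `1 ≤ r` lets `l` bound the last term.
  nlinarith

theorem le_mul_of_sum_conj_eq_neg {κ : Type*} (s : Finset κ) (V : κ → Module.End ℂ F)
    {X : Module.End ℂ F} {r l m : ℝ}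
    (h1 : ∑ k ∈ s, V k * star (V k) = (r : ℂ) • 1)
    (hX : ∑ k ∈ s, V k * X * star (V k) = -X)
    (hm : ∀ w, m * ‖w‖ ^ 2 ≤ (inner ℂ w (X w)).re)
    {v : F} (hv : ‖v‖ = 1) (hl : (inner ℂ v (X v)).re = l) : l ≤ r * (-m) := by
  have e1 := sum_norm_sq_conj s V h1 v
  have e2 := sum_inner_conj s V hX v
  have e4 : ∑ k ∈ s, m * ‖star (V k) v‖ ^ 2 ≤
      ∑ k ∈ s, (inner ℂ (star (V k) v) (X (star (V k) v))).re := Finset.sum_le_sum fun k _ => hm _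
  simp only [← Finset.mul_sum, e1, e2, LinearMap.neg_apply, inner_neg_right, Complex.neg_re,
    hv, hl] at e4
  linarith

/-- Summing the lower bound for `D + X` over the vectors `V_k* v` gives `r g ≤ r d - d`. In the
application `v = 1` and `d = ψ(A 1)`. -/
theorem degree_le_of_sum_conj_eq_neg {κ : Type*} (s : Finset κ) (V : κ → Module.End ℂ F)
    {X D : Module.End ℂ F} {r d g : ℝ}
    (h1 : ∑ k ∈ s, V k * star (V k) = (r : ℂ) • 1)
    (hX : ∑ k ∈ s, V k * X * star (V k) = -X)
    (hD : ∑ k ∈ s, V k * D * star (V k) = (r : ℂ) • D)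
    (hg : ∀ w, g * ‖w‖ ^ 2 ≤ (inner ℂ w ((D + X) w)).re)
    {v : F} (hv : ‖v‖ = 1) (hXv : (inner ℂ v (X v)).re = d) (hDv : (inner ℂ v (D v)).re = d) :
    d ≤ r * (d - g) := by
  have e1 := sum_norm_sq_conj s V h1 v
  have e2 := sum_inner_conj s V hX v
  have e3 := sum_inner_conj s V hD v
  have e4 : ∑ k ∈ s, g * ‖star (V k) v‖ ^ 2 ≤
      ∑ k ∈ s, (inner ℂ (star (V k) v) ((D + X) (star (V k) v))).re :=
    Finset.sum_le_sum fun k _ => hg _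
  simp only [LinearMap.add_apply, inner_add_right, Complex.add_re, Finset.sum_add_distrib,
    ← Finset.mul_sum, e1, e2, e3, LinearMap.neg_apply, LinearMap.smul_apply, inner_neg_right,
    inner_smul_right, Complex.neg_re, Complex.re_ofReal_mul, hv, hXv, hDv] at e4
  linarith

end QuadraticForm

/-! ### Sums of squares of positive and negative eigenvalues. -/

section SumOfSquares

theorem re_trace_sq_nonneg {ι : Type*} [Fintype ι] {Y : Matrix ι ι ℂ} (hY : star Y = Y) :
    0 ≤ (Matrix.trace (Y * Y)).re := by
  have h : 0 ≤ Matrix.trace (star Y * Y) :=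
    (Matrix.posSemidef_conjTranspose_mul_self Y).trace_nonneg
  rw [hY] at h
  exact (Complex.le_def.mp h).1

variable {ι : Type*} [Fintype ι] [DecidableEq ι]

/-- The trace is `∑ β i * β j * ‖U i j‖ ^ 2`. -/
theorem re_trace_diagonal_conj_nonneg {β : ι → ℝ} (hβ : ∀ i, 0 ≤ β i) (U : Matrix ι ι ℂ) :
    0 ≤ (Matrix.trace (Matrix.diagonal (fun i => (β i : ℂ)) *
      (U * Matrix.diagonal (fun i => (β i : ℂ)) * star U))).re := by
  rw [Matrix.trace, Complex.re_sum]
  refine Finset.sum_nonneg fun i _ => ?_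
  rw [Matrix.diag_apply, Matrix.diagonal_mul, Matrix.mul_apply, Complex.re_ofReal_mul,
    Complex.re_sum]
  refine mul_nonneg (hβ i) (Finset.sum_nonneg fun j _ => ?_)
  rw [Matrix.mul_diagonal, Matrix.star_apply, mul_right_comm, RCLike.star_def, RCLike.mul_conj,
    mul_comm, Complex.re_ofReal_mul]
  refine mul_nonneg (hβ j) ?_
  norm_cast
  exact sq_nonneg _

/-- Write the diagonal matrix as `B - C` with `B, C ≥ 0` and `B C = 0`. The pinching `Φ` is a
trace-orthogonal projection with `Φ B = Φ C = G`, so `tr BG = tr CG = tr G²`. Two estimates of `tr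
G²`, one from below by `tr B²` and one from above by `tr B²` and `tr C²`, combine to the claim. -/
theorem sum_sq_pos_le_of_pinching {n : ℕ} (hn : 1 ≤ n) {P : Fin (n + 1) → Matrix ι ι ℂ}
    (hP : ∀ a, IsStarProjection (P a)) (horth : ∀ a b, a ≠ b → P a * P b = 0)
    (hsum : ∑ a, P a = 1) {μ : ι → ℝ}
    (hμ : ∀ a, P a * Matrix.diagonal (fun i => (μ i : ℂ)) * P a = 0) :
    ∑ i with 0 < μ i, μ i ^ 2 ≤ n * ∑ i with μ i < 0, μ i ^ 2 := by
  set β : ι → ℝ := fun i => max (μ i) 0 with hβdef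
  set γ : ι → ℝ := fun i => max (-μ i) 0 with hγdef
  have hβ : ∀ i, 0 ≤ β i := fun i => le_max_right _ _
  set B : Matrix ι ι ℂ := Matrix.diagonal fun i => (β i : ℂ) with hB
  set C : Matrix ι ι ℂ := Matrix.diagonal fun i => (γ i : ℂ) with hC
  set Φ : Matrix ι ι ℂ → Matrix ι ι ℂ := fun X => ∑ a, P a * X * P a with hΦ
  have hβγ : ∀ i, μ i = β i - γ i ∧ β i * γ i = 0 := by
    intro i
    simp only [hβdef, hγdef]
    rcases le_total (μ i) 0 with h | h
    · rw [max_eq_right h, max_eq_left (by linarith)]; constructor <;> ring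
    · rw [max_eq_left h, max_eq_right (by linarith)]; constructor <;> ring
  have hBC : Matrix.diagonal (fun i => (μ i : ℂ)) = B - C := by
    rw [hB, hC, Matrix.diagonal_sub]
    congr 1
    funext i
    rw [← Complex.ofReal_sub, ← (hβγ i).1]
  have hG : Φ B = Φ C := by
    refine Finset.sum_congr rfl fun a _ => ?_
    have := hμ a
    rwa [hBC, mul_sub, sub_mul, sub_eq_zero] at this
  have hadj : ∀ X Y, Matrix.trace (X * Φ Y) = Matrix.trace (Φ X * Y) := by
    intro X Y
    simp only [hΦ, Finset.mul_sum, Finset.sum_mul, Matrix.trace_sum]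
    refine Finset.sum_congr rfl fun a _ => ?_
    rw [← mul_assoc, Matrix.trace_mul_comm]
    simp only [mul_assoc]
  have hidem : ∀ X, Φ (Φ X) = Φ X := by
    intro X
    simp only [hΦ]
    refine Finset.sum_congr rfl fun a _ => ?_
    rw [Finset.mul_sum, Finset.sum_mul, Finset.sum_eq_single a]
    · rw [← mul_assoc, ← mul_assoc, (hP a).isIdempotentElem.eq, mul_assoc,
        (hP a).isIdempotentElem.eq]
    · intro b _ hb
      rw [← mul_assoc, ← mul_assoc, horth a b hb.symm]
      simp
    · simp
  have hXG : ∀ X, Matrix.trace (X * Φ X) = Matrix.trace (Φ X * Φ X) := by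
    intro X
    rw [← hadj X (Φ X), hidem]
  have hBG := hXG B
  have hCG := hXG C
  rw [← hG] at hCG
  have hBC0 : B * C = 0 := by
    rw [hB, hC, Matrix.diagonal_mul_diagonal, ← Matrix.diagonal_zero]
    congr 1
    funext i
    rw [← Complex.ofReal_mul, (hβγ i).2, Complex.ofReal_zero]
  have hCB0 : C * B = 0 := by
    rw [hB, hC, Matrix.diagonal_mul_diagonal, ← Matrix.diagonal_zero]
    congr 1
    funext i
    rw [← Complex.ofReal_mul, mul_comm, (hβγ i).2, Complex.ofReal_zero]
  have htr : ∀ f : ι → ℝ, (Matrix.trace (Matrix.diagonal (fun i => (f i : ℂ)) *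
      Matrix.diagonal (fun i => (f i : ℂ)))).re = ∑ i, f i ^ 2 := by
    intro f
    rw [Matrix.diagonal_mul_diagonal, Matrix.trace_diagonal, Complex.re_sum]
    refine Finset.sum_congr rfl fun i _ => ?_
    rw [← Complex.ofReal_mul, Complex.ofReal_re, sq]
  have hTB : (Matrix.trace (B * B)).re = ∑ i with 0 < μ i, μ i ^ 2 := by
    rw [hB, htr, Finset.sum_filter]
    refine Finset.sum_congr rfl fun i _ => ?_
    split_ifs with h
    · simp only [hβdef, max_eq_left h.le]
    · simp only [hβdef, max_eq_right (not_lt.mp h)]; ring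
  have hTC : (Matrix.trace (C * C)).re = ∑ i with μ i < 0, μ i ^ 2 := by
    rw [hC, htr, Finset.sum_filter]
    refine Finset.sum_congr rfl fun i _ => ?_
    split_ifs with h
    · simp only [hγdef, max_eq_left (neg_nonneg.mpr h.le)]; ring
    · simp only [hγdef, max_eq_right (neg_nonpos.mpr (not_lt.mp h))]; ring
  rw [← hTB, ← hTC]
  -- `(n + 1) tr BG` is the sum of the traces `tr (B U ^ k B (U ^ k)*)`. All are nonnegative, and `k
  -- = 0` gives `tr B²`.
  have hpinch : (Matrix.trace (B * B)).re ≤ (n + 1) * (Matrix.trace (Φ B * Φ B)).re := by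
    have h := congrArg (fun X => (Matrix.trace (B * X)).re) (sum_clockUnitary_conj hP B)
    simp only [mul_smul_comm, Matrix.trace_smul, smul_eq_mul] at h
    rw [show ∑ a, P a * B * P a = Φ B from rfl, hBG] at h
    simp only [Finset.mul_sum, Matrix.trace_sum, Complex.re_sum] at h
    rw [Finset.sum_range_succ', clockUnitary_zero hsum] at h
    have h2 : 0 ≤ ∑ k ∈ Finset.range n, (Matrix.trace
        (B * (clockUnitary P (k + 1) * B * star (clockUnitary P (k + 1))))).re :=
      Finset.sum_nonneg fun k _ => re_trace_diagonal_conj_nonneg hβ _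
    rw [star_one, one_mul, mul_one] at h
    have h4 : (((n + 1 : ℕ) : ℂ) * Matrix.trace (Φ B * Φ B)).re =
        (n + 1) * (Matrix.trace (Φ B * Φ B)).re := by
      rw [← Complex.ofReal_natCast, Complex.re_ofReal_mul]
      push_cast
      rfl
    rw [h4] at h
    linarith
  have hdiag : ∀ f : ι → ℝ, star (Matrix.diagonal fun i => (f i : ℂ)) =
      Matrix.diagonal fun i => (f i : ℂ) := by
    intro f
    rw [Matrix.star_eq_conjTranspose, Matrix.diagonal_conjTranspose]
    congr 1
    funext i
    simp
  have hΦstar : star (Φ B) = Φ B := by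
    simp only [hΦ, star_sum, star_mul]
    refine Finset.sum_congr rfl fun a _ => ?_
    rw [(hP a).isSelfAdjoint.star_eq, hB, hdiag, mul_assoc]
  -- The coefficients make the square expand to `tr B² + n² tr C² - (n + 1)² tr G²`. With `hpinch`
  -- this gives `n tr B² ≤ n² tr C²`, and `n` cancels.
  have hY := re_trace_sq_nonneg (Y := B + (n : ℂ) • C - (n + 1 : ℂ) • Φ B) (by
    rw [star_sub, star_add, star_smul, star_smul, hΦstar, hB, hC, hdiag, hdiag]
    simp)
  have hexp : Matrix.trace ((B + (n : ℂ) • C - (n + 1 : ℂ) • Φ B) *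
      (B + (n : ℂ) • C - (n + 1 : ℂ) • Φ B)) = Matrix.trace (B * B) +
      ((n ^ 2 : ℝ) : ℂ) * Matrix.trace (C * C) -
        (((n + 1) ^ 2 : ℝ) : ℂ) * Matrix.trace (Φ B * Φ B) := by
    simp only [mul_add, add_mul, mul_sub, sub_mul, smul_mul_assoc, mul_smul_comm,
      Matrix.trace_add, Matrix.trace_sub, Matrix.trace_smul, smul_eq_mul, hBC0, hCB0,
      Matrix.trace_mul_comm (Φ B) B, Matrix.trace_mul_comm (Φ B) C, hBG, hCG, Matrix.trace_zero]
    push_cast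
    ring
  rw [hexp, Complex.sub_re, Complex.add_re, Complex.re_ofReal_mul, Complex.re_ofReal_mul] at hY
  have hn' : (1 : ℝ) ≤ n := by exact_mod_cast hn
  have hfin : (n : ℝ) * (Matrix.trace (B * B)).re ≤ n * (n * (Matrix.trace (C * C)).re) := by
    nlinarith
  exact le_of_mul_le_mul_left hfin (by linarith)

end SumOfSquares

section SumOfSquaresOperator

variable {F : Type*} [NormedAddCommGroup F] [InnerProductSpace ℂ F] [FiniteDimensional ℂ F]

theorem sum_sq_pos_le_of_annihilate {ι : Type*} [Fintype ι] (b : OrthonormalBasis ι ℂ F)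
    {X : Module.End ℂ F} {μ : ι → ℝ} (hX : ∀ i, X (b i) = (μ i : ℂ) • b i) {n : ℕ} (hn : 1 ≤ n)
    {P : Fin (n + 1) → Module.End ℂ F} (hP : ∀ a, IsStarProjection (P a)) (hsum : ∑ a, P a = 1)
    (hPX : ∀ a, P a * X * P a = 0) :
    ∑ i with 0 < μ i, μ i ^ 2 ≤ n * ∑ i with μ i < 0, μ i ^ 2 := by
  classical
  have hXm : LinearMap.toMatrixOrthonormal b X = Matrix.diagonal fun i => (μ i : ℂ) := by
    ext i j
    rw [LinearMap.toMatrixOrthonormal_apply_apply, hX, inner_smul_right, b.inner_eq_ite,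
      Matrix.diagonal_apply]
    split_ifs with h
    · rw [h, mul_one]
    · rw [mul_zero]
  refine sum_sq_pos_le_of_pinching hn (P := fun a => LinearMap.toMatrixOrthonormal b (P a))
    (fun a => (hP a).map _) (fun a a' h => ?_) ?_ fun a => ?_
  · rw [← map_mul, orthogonal_of_sum_eq_one hP hsum a a' h, map_zero]
  · rw [← map_sum, hsum, map_one]
  · rw [← hXm, ← map_mul, ← map_mul, hPX, map_zero]

end SumOfSquaresOperator

/-! ### Multiplication and comultiplication of `L²(M)` in an orthonormal basis. -/

namespace FaithfulState

variable {M : Type*} [CStarAlgebra M]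

/-- An operator on `L²(M)`, viewed as a linear map on `M`. -/
def onAlgebra (ψ : FaithfulState M) (X : Module.End ℂ ψ.L2) : M →ₗ[ℂ] M :=
  ψ.toL2.symm.toLinearMap ∘ₗ X ∘ₗ ψ.toL2.toLinearMap

theorem apply_toL2 (ψ : FaithfulState M) (X : Module.End ℂ ψ.L2) (x : M) :
    X (ψ.toL2 x) = ψ.toL2 (ψ.onAlgebra X x) := rfl

theorem onAlgebra_injective (ψ : FaithfulState M) : Function.Injective ψ.onAlgebra := by
  intro X Y h
  ext x
  exact LinearMap.congr_fun h (ψ.toL2.symm x)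

theorem leftReg_toL2 (ψ : FaithfulState M) (a x : M) :
    ψ.leftReg a (ψ.toL2 x) = ψ.toL2 (a * x) := rfl

theorem degree_toL2 (ψ : FaithfulState M) (A : Module.End ℂ ψ.L2) (x : M) :
    ψ.degree A (ψ.toL2 x) = ψ.toL2 (x * ψ.onAlgebra A 1) := rfl

theorem degree_commute_leftReg (ψ : FaithfulState M) (A : Module.End ℂ ψ.L2) (a : M) :
    Commute (ψ.leftReg a) (ψ.degree A) := by
  ext x
  obtain ⟨x, rfl⟩ := ψ.toL2.surjective x
  change ψ.leftReg a (ψ.degree A (ψ.toL2 x)) = ψ.degree A (ψ.leftReg a (ψ.toL2 x))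
  rw [degree_toL2, leftReg_toL2, leftReg_toL2, degree_toL2, mul_assoc]

theorem mulMap_tmul (ψ : FaithfulState M) (x y : M) :
    ψ.mulMap (ψ.toL2 x ⊗ₜ ψ.toL2 y) = ψ.toL2 (x * y) := rfl

theorem norm_toL2_one (ψ : FaithfulState M) : ‖ψ.toL2 1‖ = 1 := by
  have h : inner ℂ (ψ.toL2 1) (ψ.toL2 1) = 1 := by
    rw [ψ.inner_def, star_one, one_mul, ψ.map_one]
  rw [norm_eq_sqrt_re_inner (𝕜 := ℂ), h]
  simp

theorem eq_of_forall_state_mul (ψ : FaithfulState M) {x y : M}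
    (h : ∀ z, ψ.toFun (z * x) = ψ.toFun (z * y)) : x = y := by
  have h1 := h (star (x - y))
  rw [← sub_eq_zero, ← map_sub, ← mul_sub] at h1
  exact sub_eq_zero.mp (ψ.faithful _ h1)

section Basis

variable {ι : Type*} [Fintype ι] (ψ : FaithfulState M) (b : OrthonormalBasis ι ℂ ψ.L2)

/-- The element of `M` underlying a vector of an orthonormal basis of `L²(M)`. -/
def basisElem (i : ι) : M := ψ.toL2.symm (b i)

theorem toL2_basisElem (i : ι) : ψ.toL2 (ψ.basisElem b i) = b i := rfl

theorem sum_state_smul_basisElem (x : M) :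
    ∑ i, ψ.toFun (star (ψ.basisElem b i) * x) • ψ.basisElem b i = x := by
  have h := congrArg ψ.toL2.symm (b.sum_repr' (ψ.toL2 x))
  rw [map_sum] at h
  exact h

theorem sum_state_mul_state (x y : M) :
    ∑ i, ψ.toFun (x * ψ.basisElem b i) * ψ.toFun (star (ψ.basisElem b i) * y) =
      ψ.toFun (x * y) := by
  conv_rhs => rw [← ψ.sum_state_smul_basisElem b y]
  rw [Finset.mul_sum, map_sum]
  refine Finset.sum_congr rfl fun i _ => ?_
  rw [mul_smul_comm, map_smul, smul_eq_mul, mul_comm]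

theorem trace_eq_sum_state (X : Module.End ℂ ψ.L2) :
    LinearMap.trace ℂ ψ.L2 X =
      ∑ i, ψ.toFun (star (ψ.basisElem b i) * ψ.onAlgebra X (ψ.basisElem b i)) := by
  rw [LinearMap.trace_eq_sum_inner X b]
  rfl

end Basis

variable [FiniteDimensional ℂ M]

section Basis

variable {ι : Type*} [Fintype ι] {ψ : FaithfulState M} (b : OrthonormalBasis ι ℂ ψ.L2)

theorem star_leftReg (ψ : FaithfulState M) (a : M) :
    star (ψ.leftReg a) = ψ.leftReg (star a) := by
  rw [LinearMap.star_eq_adjoint, eq_comm, LinearMap.eq_adjoint_iff]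
  intro x y
  change ψ.toFun (star (star a * ψ.toL2.symm x) * ψ.toL2.symm y) =
    ψ.toFun (star (ψ.toL2.symm x) * (a * ψ.toL2.symm y))
  rw [star_mul, star_star, mul_assoc]

/-- Parseval's identity, after traciality has moved `y*` next to `w`. The argument is split as `z *
w` because the idempotence of `edgeProj` needs a factor on each side. -/
theorem comulMap_toL2_mul (hψ : ψ.IsTracial) (z w : M) :
    ψ.comulMap (ψ.toL2 (z * w)) =
      ∑ i, ψ.toL2 (z * ψ.basisElem b i) ⊗ₜ ψ.toL2 (star (ψ.basisElem b i) * w) := by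
  rw [TensorProduct.ext_iff_inner_left]
  intro x y
  obtain ⟨x, rfl⟩ := ψ.toL2.surjective x
  obtain ⟨y, rfl⟩ := ψ.toL2.surjective y
  rw [comulMap, LinearMap.adjoint_inner_right, mulMap_tmul, inner_sum, ψ.inner_def]
  have h := ψ.sum_state_mul_state b (star x * z) (w * star y)
  have h' : ψ.toFun (star (x * y) * (z * w)) = ψ.toFun (star x * z * (w * star y)) := by
    rw [star_mul, mul_assoc, hψ]
    simp only [mul_assoc]
  rw [h', ← h]
  refine Finset.sum_congr rfl fun i _ => ?_
  rw [TensorProduct.inner_tmul, ψ.inner_def, ψ.inner_def, mul_assoc (star x),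
    hψ (star y), mul_assoc (star _)]

theorem onAlgebra_schur_mul (hψ : ψ.IsTracial) (X Y : Module.End ℂ ψ.L2) (z w : M) :
    ψ.onAlgebra (ψ.schur X Y) (z * w) =
      ∑ i, ψ.onAlgebra X (z * ψ.basisElem b i) * ψ.onAlgebra Y (star (ψ.basisElem b i) * w) := by
  apply ψ.toL2.injective
  rw [← apply_toL2, schur, LinearMap.comp_apply, LinearMap.comp_apply, comulMap_toL2_mul b hψ,
    map_sum, map_sum, map_sum]
  rfl

theorem onAlgebra_schur (hψ : ψ.IsTracial) (X Y : Module.End ℂ ψ.L2) (z : M) :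
    ψ.onAlgebra (ψ.schur X Y) z =
      ∑ i, ψ.onAlgebra X (z * ψ.basisElem b i) * ψ.onAlgebra Y (star (ψ.basisElem b i)) := by
  have h := onAlgebra_schur_mul b hψ X Y z 1
  simpa only [mul_one] using h

theorem sum_basisElem_mul_star (hψ : ψ.IsTracial) {δ : ℝ} (hδ : ψ.IsDeltaForm δ) :
    ∑ i, ψ.basisElem b i * star (ψ.basisElem b i) = (δ : ℂ) ^ 2 • (1 : M) := by
  have h := LinearMap.congr_fun hδ.2 (ψ.toL2 (1 * 1))
  rw [LinearMap.comp_apply, comulMap_toL2_mul b hψ, map_sum] at h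
  simp only [mulMap_tmul, one_mul, mul_one] at h
  rw [← map_sum] at h
  exact h

/-- Expanding each `e_i*` in the basis turns both orders of the product into the same double sum,
since the coefficients `ψ(e_j* e_i*)` are symmetric. -/
theorem sum_star_mul_basisElem (hψ : ψ.IsTracial) {δ : ℝ} (hδ : ψ.IsDeltaForm δ) :
    ∑ i, star (ψ.basisElem b i) * ψ.basisElem b i = (δ : ℂ) ^ 2 • (1 : M) := by
  rw [← sum_basisElem_mul_star b hψ hδ]
  have h1 : ∀ i, star (ψ.basisElem b i) * ψ.basisElem b i =
      ∑ j, ψ.toFun (star (ψ.basisElem b j) * star (ψ.basisElem b i)) •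
        (ψ.basisElem b j * ψ.basisElem b i) := by
    intro i
    conv_lhs => rw [← ψ.sum_state_smul_basisElem b (star (ψ.basisElem b i)), Finset.sum_mul]
    simp only [smul_mul_assoc]
  have h2 : ∀ j, ψ.basisElem b j * star (ψ.basisElem b j) =
      ∑ i, ψ.toFun (star (ψ.basisElem b i) * star (ψ.basisElem b j)) •
        (ψ.basisElem b j * ψ.basisElem b i) := by
    intro j
    conv_lhs => rw [← ψ.sum_state_smul_basisElem b (star (ψ.basisElem b j)), Finset.mul_sum]
    simp only [mul_smul_comm]
  rw [Finset.sum_congr rfl fun i _ => h1 i, Finset.sum_congr rfl fun i _ => h2 i, Finset.sum_comm]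
  refine Finset.sum_congr rfl fun j _ => Finset.sum_congr rfl fun i _ => ?_
  rw [hψ]

end Basis

/-! ### Consequences of the axioms on `A`: reality, trace zero, `dim S`. -/

section Adjacency

variable {ψ : FaithfulState M} {δ : ℝ} {A : Module.End ℂ ψ.L2}

theorem finrank_eq_sq (hψ : ψ.IsTracial) (hδ : ψ.IsDeltaForm δ) :
    (Module.finrank ℂ M : ℂ) = (δ : ℂ) ^ 2 := by
  have h1 := ψ.trace_eq_sum_state (stdOrthonormalBasis ℂ ψ.L2) 1
  rw [LinearMap.trace_one] at h1
  change (Module.finrank ℂ M : ℂ) = _ at h1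
  rw [h1]
  change ∑ i, ψ.toFun (star (ψ.basisElem _ i) * ψ.basisElem _ i) = _
  rw [← map_sum, sum_star_mul_basisElem _ hψ hδ, map_smul, ψ.map_one, smul_eq_mul, mul_one]

theorem onAlgebra_flipAdj (hψ : ψ.IsTracial) {ι : Type*} [Fintype ι]
    (b : OrthonormalBasis ι ℂ ψ.L2) (x : M) :
    ψ.onAlgebra (ψ.flipAdj A) x =
      ∑ i, ψ.toFun (ψ.onAlgebra A (star (ψ.basisElem b i)) * x) • ψ.basisElem b i := by
  apply ψ.toL2.injective
  have hη : ψ.unitMap 1 = ψ.toL2 (1 * 1) := by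
    simp [unitMap]
  have hη' : ∀ y, LinearMap.adjoint ψ.unitMap (ψ.toL2 y) = ψ.toFun y := by
    intro y
    have h := LinearMap.adjoint_inner_right ψ.unitMap (1 : ℂ) (ψ.toL2 y)
    rw [hη, ψ.inner_def, mul_one, star_one, one_mul] at h
    rw [← h]
    simp
  rw [← apply_toL2, flipAdj]
  simp only [LinearMap.comp_apply, LinearEquiv.coe_coe, TensorProduct.lid_symm_apply,
    LinearMap.rTensor_tmul, hη]
  rw [comulMap_toL2_mul b hψ, TensorProduct.sum_tmul]
  simp only [map_sum, TensorProduct.assoc_tmul, LinearMap.lTensor_tmul, LinearMap.rTensor_tmul,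
    LinearMap.comp_apply, TensorProduct.rid_tmul, one_mul, mul_one, apply_toL2, mulMap_tmul, hη',
    map_smul]

/-- The flip condition moves `A` across the bilinear form `ψ(x y)`, and self-adjointness moves it
across `ψ(x* y)`. Comparing the two shows that `A` respects the involution. -/
theorem onAlgebra_star (hψ : ψ.IsTracial) (hA : ψ.IsQuantumAdjacency δ A) (x : M) :
    ψ.onAlgebra A (star x) = star (ψ.onAlgebra A x) := by
  have b := stdOrthonormalBasis ℂ ψ.L2
  have key : ∀ y, ψ.toFun (star (ψ.onAlgebra A x) * y) = ψ.toFun (ψ.onAlgebra A (star x) * y) := by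
    intro y
    have h1 : ψ.toFun (star (ψ.onAlgebra A x) * y) = ψ.toFun (star x * ψ.onAlgebra A y) :=
      hA.selfAdjoint (ψ.toL2 x) (ψ.toL2 y)
    rw [h1]
    conv_lhs => rw [← hA.flip_self, onAlgebra_flipAdj hψ b, Finset.mul_sum, map_sum]
    have h2 : star x = ∑ i, ψ.toFun (star x * ψ.basisElem b i) • star (ψ.basisElem b i) := by
      conv_lhs => rw [← ψ.sum_state_smul_basisElem b x, star_sum]
      refine Finset.sum_congr rfl fun i _ => ?_
      rw [star_smul, RCLike.star_def, ← ψ.map_star, star_mul, star_star]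
    conv_rhs => rw [h2, map_sum, Finset.sum_mul, map_sum]
    refine Finset.sum_congr rfl fun i _ => ?_
    rw [mul_smul_comm, map_smul, map_smul, smul_mul_assoc, map_smul, smul_eq_mul, smul_eq_mul,
      mul_comm]
  refine ψ.eq_of_forall_state_mul fun z => ?_
  rw [hψ, ← key, hψ]

theorem onAlgebra_one_selfAdjoint (hψ : ψ.IsTracial) (hA : ψ.IsQuantumAdjacency δ A) :
    star (ψ.onAlgebra A 1) = ψ.onAlgebra A 1 := by
  rw [← onAlgebra_star hψ hA, star_one]

theorem degree_isSymmetric (hψ : ψ.IsTracial) (hA : ψ.IsQuantumAdjacency δ A) :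
    (ψ.degree A).IsSymmetric := by
  intro x y
  obtain ⟨x, rfl⟩ := ψ.toL2.surjective x
  obtain ⟨y, rfl⟩ := ψ.toL2.surjective y
  rw [degree_toL2, degree_toL2, ψ.inner_def, ψ.inner_def, star_mul,
    onAlgebra_one_selfAdjoint hψ hA, mul_assoc, hψ, mul_assoc]

theorem sum_onAlgebra_mul_star (hψ : ψ.IsTracial) (hirr : ψ.IsIrreflexive A) {ι : Type*}
    [Fintype ι] (b : OrthonormalBasis ι ℂ ψ.L2) (z : M) :
    ∑ i, ψ.onAlgebra A (z * ψ.basisElem b i) * star (ψ.basisElem b i) = 0 := by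
  have h := onAlgebra_schur b hψ A LinearMap.id z
  rw [hirr] at h
  exact h.symm

theorem trace_eq_zero (hψ : ψ.IsTracial) (hirr : ψ.IsIrreflexive A) :
    LinearMap.trace ℂ ψ.L2 A = 0 := by
  have h := congrArg ψ.toFun (sum_onAlgebra_mul_star hψ hirr (stdOrthonormalBasis ℂ ψ.L2) 1)
  rw [ψ.trace_eq_sum_state (stdOrthonormalBasis ℂ ψ.L2), ← map_zero ψ.toFun, ← h, map_sum]
  refine Finset.sum_congr rfl fun i _ => ?_
  rw [hψ, one_mul]

theorem trace_degree (hψ : ψ.IsTracial) (hδ : ψ.IsDeltaForm δ) :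
    LinearMap.trace ℂ ψ.L2 (ψ.degree A) = Module.finrank ℂ M * ψ.toFun (ψ.onAlgebra A 1) := by
  rw [ψ.trace_eq_sum_state (stdOrthonormalBasis ℂ ψ.L2), finrank_eq_sq hψ hδ]
  change ∑ i, ψ.toFun (star (ψ.basisElem _ i) * (ψ.basisElem _ i * ψ.onAlgebra A 1)) = _
  simp only [← mul_assoc]
  rw [← map_sum, ← Finset.sum_mul, sum_star_mul_basisElem _ hψ hδ, smul_mul_assoc, one_mul,
    map_smul, smul_eq_mul]

theorem sum_leftReg_mul_star (hψ : ψ.IsTracial) (hδ : ψ.IsDeltaForm δ) {ι : Type*}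
    [Fintype ι] (b : OrthonormalBasis ι ℂ ψ.L2) :
    ∑ i, ψ.leftReg (ψ.basisElem b i) * star (ψ.leftReg (ψ.basisElem b i)) =
      (δ : ℂ) ^ 2 • 1 := by
  simp only [star_leftReg, ← map_mul]
  rw [← map_sum, sum_basisElem_mul_star b hψ hδ, map_smul, _root_.map_one]

/-- This is the adjoint of the irreflexivity identity taken at `star x`, as `A` commutes with the
involution. -/
theorem sum_leftReg_conj (hψ : ψ.IsTracial) (hA : ψ.IsQuantumAdjacency δ A)
    (hirr : ψ.IsIrreflexive A) {ι : Type*} [Fintype ι] (b : OrthonormalBasis ι ℂ ψ.L2) :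
    ∑ i, ψ.leftReg (ψ.basisElem b i) * A * star (ψ.leftReg (ψ.basisElem b i)) = 0 := by
  ext x
  obtain ⟨x, rfl⟩ := ψ.toL2.surjective x
  simp only [star_leftReg, LinearMap.sum_apply]
  have h := congrArg star (sum_onAlgebra_mul_star hψ hirr b (star x))
  simp only [star_sum, star_mul, star_star, star_zero, ← onAlgebra_star hψ hA] at h
  have h' := congrArg ψ.toL2 h
  rw [map_sum] at h'
  exact h'

theorem adjacency_mem_edgeSpace (hδ : ψ.IsDeltaForm δ) (hA : ψ.IsQuantumAdjacency δ A) :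
    A ∈ ψ.edgeSpace δ A := by
  refine ⟨A, ?_⟩
  change ((δ : ℂ) ^ 2)⁻¹ • ψ.schur A A = A
  have h : (δ : ℂ) ^ 2 ≠ 0 := pow_ne_zero 2 (Complex.ofReal_ne_zero.mpr hδ.1.ne')
  rw [hA.schur_self, smul_smul, inv_mul_cancel₀ h, one_smul]

theorem edgeSpace_eq_bot_iff (hδ : ψ.IsDeltaForm δ) (hA : ψ.IsQuantumAdjacency δ A) :
    ψ.edgeSpace δ A = ⊥ ↔ A = 0 := by
  constructor
  · intro h
    have := adjacency_mem_edgeSpace hδ hA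
    rwa [h, Submodule.mem_bot] at this
  · rintro rfl
    rw [edgeSpace, LinearMap.range_eq_bot]
    ext1 X
    change ((δ : ℂ) ^ 2)⁻¹ • ψ.schur 0 X = 0
    rw [schur, TensorProduct.map_zero_left, LinearMap.zero_comp, LinearMap.comp_zero, smul_zero]

theorem onAlgebra_edgeProj (hψ : ψ.IsTracial) {ι : Type*} [Fintype ι]
    (b : OrthonormalBasis ι ℂ ψ.L2) (X : Module.End ℂ ψ.L2) (z : M) :
    ψ.onAlgebra (ψ.edgeProj δ A X) z = ((δ : ℂ) ^ 2)⁻¹ •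
      ∑ i, ψ.onAlgebra A (z * ψ.basisElem b i) * ψ.onAlgebra X (star (ψ.basisElem b i)) := by
  rw [← onAlgebra_schur b hψ]
  rfl

/-- The Schur product is associative, and `δ⁻² m (A ⊗ A) m* = A`. -/
theorem edgeProj_isIdempotentElem (hψ : ψ.IsTracial) (hδ : ψ.IsDeltaForm δ)
    (hA : ψ.IsQuantumAdjacency δ A) : IsIdempotentElem (ψ.edgeProj δ A) := by
  have h0 : (δ : ℂ) ^ 2 ≠ 0 := pow_ne_zero 2 (Complex.ofReal_ne_zero.mpr hδ.1.ne')
  have b := stdOrthonormalBasis ℂ ψ.L2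
  refine LinearMap.ext fun X => ψ.onAlgebra_injective (LinearMap.ext fun z => ?_)
  rw [Module.End.mul_apply, onAlgebra_edgeProj hψ b, onAlgebra_edgeProj hψ b]
  congr 1
  simp only [onAlgebra_edgeProj hψ b X (star _), mul_smul_comm, Finset.mul_sum, ← mul_assoc]
  rw [← Finset.smul_sum, Finset.sum_comm]
  simp only [← Finset.sum_mul, ← onAlgebra_schur_mul b hψ A A, hA.schur_self]
  rw [Finset.smul_sum]
  refine Finset.sum_congr rfl fun i _ => ?_
  change ((δ : ℂ) ^ 2)⁻¹ • (((δ : ℂ) ^ 2 • ψ.onAlgebra A _) * _) = _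
  rw [smul_mul_assoc, smul_smul, inv_mul_cancel₀ h0, one_smul]
  rfl

/-- On matrix units the diagonal coefficient is `δ⁻² ψ(e_i* A(e_j e_j*) e_i)`. Summing over `j` and
then over `i` uses `∑ e e* = δ²` twice. As the trace of an idempotent is its rank, this computes
`dim S`. -/
theorem trace_edgeProj (hψ : ψ.IsTracial) (hδ : ψ.IsDeltaForm δ) :
    LinearMap.trace ℂ _ (ψ.edgeProj δ A) = Module.finrank ℂ M * ψ.toFun (ψ.onAlgebra A 1) := by
  have h0 : (δ : ℂ) ^ 2 ≠ 0 := pow_ne_zero 2 (Complex.ofReal_ne_zero.mpr hδ.1.ne')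
  set b := stdOrthonormalBasis ℂ ψ.L2
  have hE : ∀ i j, ∀ y : M, ψ.onAlgebra (b.toBasis.end (i, j)) y =
      ψ.toFun (star (ψ.basisElem b j) * y) • ψ.basisElem b i := by
    intro i j y
    conv_lhs => rw [← ψ.sum_state_smul_basisElem b y, map_sum]
    rw [Finset.sum_eq_single j]
    · rw [map_smul]
      congr 1
      apply ψ.toL2.injective
      rw [← apply_toL2, toL2_basisElem, toL2_basisElem]
      have := b.toBasis.end_apply_apply (i, j) j
      simpa using this
    · intro k _ hk
      rw [map_smul]
      have := b.toBasis.end_apply_apply (i, j) k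
      rw [if_neg hk.symm, b.coe_toBasis, ← toL2_basisElem, apply_toL2] at this
      rw [ψ.toL2.map_eq_zero_iff.mp this, smul_zero]
    · simp
  have hdiag : ∀ i j, ψ.onAlgebra (ψ.edgeProj δ A (b.toBasis.end (i, j))) (ψ.basisElem b j) =
      ((δ : ℂ) ^ 2)⁻¹ • (ψ.onAlgebra A (ψ.basisElem b j * star (ψ.basisElem b j)) *
        ψ.basisElem b i) := by
    intro i j
    rw [onAlgebra_edgeProj hψ b]
    congr 1
    simp only [hE, mul_smul_comm]
    conv_rhs => rw [← ψ.sum_state_smul_basisElem b (star (ψ.basisElem b j)), Finset.mul_sum,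
      map_sum, Finset.sum_mul]
    refine Finset.sum_congr rfl fun k _ => ?_
    rw [mul_smul_comm, map_smul, smul_mul_assoc, hψ]
  rw [LinearMap.trace_eq_matrix_trace ℂ b.toBasis.end, Matrix.trace]
  have hterm : ∀ i j, (LinearMap.toMatrix b.toBasis.end b.toBasis.end (ψ.edgeProj δ A)).diag (i, j)
      = ((δ : ℂ) ^ 2)⁻¹ * ψ.toFun (star (ψ.basisElem b i) *
        (ψ.onAlgebra A (ψ.basisElem b j * star (ψ.basisElem b j)) * ψ.basisElem b i)) := by
    intro i j
    rw [Matrix.diag_apply, LinearMap.toMatrix_apply]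
    have h1 : ∀ Y : Module.End ℂ ψ.L2, b.toBasis.end.repr Y (i, j) =
        ψ.toFun (star (ψ.basisElem b i) * ψ.onAlgebra Y (ψ.basisElem b j)) := by
      intro Y
      have h2 : b.toBasis.end.repr Y (i, j) = LinearMap.toMatrix b.toBasis b.toBasis Y i j := by
        simp [Matrix.stdBasis]
      rw [h2, LinearMap.toMatrix_apply, b.coe_toBasis, b.coe_toBasis_repr_apply,
        b.repr_apply_apply]
      rfl
    rw [h1, hdiag, mul_smul_comm, map_smul, smul_eq_mul]
  rw [Fintype.sum_prod_type]
  simp only [hterm, ← Finset.mul_sum]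
  simp only [← map_sum, ← Finset.mul_sum, ← Finset.sum_mul, sum_basisElem_mul_star b hψ hδ]
  have h3 : ∀ i, ψ.toFun (star (ψ.basisElem b i) *
      (ψ.onAlgebra A ((δ : ℂ) ^ 2 • 1) * ψ.basisElem b i)) =
      (δ : ℂ) ^ 2 * ψ.toFun (ψ.onAlgebra A 1 * (ψ.basisElem b i * star (ψ.basisElem b i))) := by
    intro i
    rw [hψ, map_smul, smul_mul_assoc, smul_mul_assoc, map_smul, smul_eq_mul, mul_assoc]
  simp only [map_sum, h3, ← Finset.mul_sum]
  rw [← map_sum, ← Finset.mul_sum, sum_basisElem_mul_star b hψ hδ, mul_smul_comm, mul_one,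
    map_smul, smul_eq_mul, inv_mul_cancel_left₀ h0, finrank_eq_sq hψ hδ]

theorem finrank_edgeSpace (hψ : ψ.IsTracial) (hδ : ψ.IsDeltaForm δ)
    (hA : ψ.IsQuantumAdjacency δ A) :
    (Module.finrank ℂ (ψ.edgeSpace δ A) : ℝ) =
      Module.finrank ℂ M * (ψ.toFun (ψ.onAlgebra A 1)).re := by
  have h := (LinearMap.IsIdempotentElem.isProj_range _
    (edgeProj_isIdempotentElem hψ hδ hA)).trace
  rw [trace_edgeProj hψ hδ] at h
  have h' := congrArg Complex.re h
  rw [← Complex.ofReal_natCast, Complex.re_ofReal_mul, Complex.natCast_re] at h'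
  exact h'.symm

end Adjacency

end FaithfulState

/-! ### Extreme eigenvalues of `T` and of `T ⊗ 1`. -/

section ExtremeEigenvalues

variable {E : Type*} [NormedAddCommGroup E] [InnerProductSpace ℂ E]
  {T : Module.End ℂ E}

theorem re_inner_rTensor_tmul {K : Type*} [NormedAddCommGroup K]
    [InnerProductSpace ℂ K] (X : Module.End ℂ E) (v : E) {f : K} (hf : ‖f‖ = 1) :
    (inner ℂ (v ⊗ₜ f) (LinearMap.rTensor K X (v ⊗ₜ f))).re = (inner ℂ v (X v)).re := by
  rw [LinearMap.rTensor_tmul, TensorProduct.inner_tmul, inner_self_eq_norm_sq_to_K, hf]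
  simp

theorem re_inner_apply_of_eigenvector {v : E} (hv : ‖v‖ = 1) {r : ℝ}
    (h : T v = (r : ℂ) • v) : (inner ℂ v (T v)).re = r := by
  rw [h, inner_smul_right, inner_self_eq_norm_sq_to_K, hv]
  simp

variable [FiniteDimensional ℂ E]

theorem setOf_hasEigenvalue_eq_range (hT : T.IsSymmetric) :
    {r : ℝ | T.HasEigenvalue (r : ℂ)} = Set.range (hT.eigenvalues rfl) := by
  ext r
  constructor
  · intro hr
    obtain ⟨i, hi⟩ := hT.exists_eigenvalues_eq rfl hr
    exact ⟨i, Complex.ofReal_injective hi⟩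
  · rintro ⟨i, rfl⟩
    exact hT.hasEigenvalue_eigenvalues rfl i

theorem eigenvalues_le_maxEigenvalue (hT : T.IsSymmetric) (i) :
    hT.eigenvalues rfl i ≤ maxEigenvalue T := by
  rw [maxEigenvalue, setOf_hasEigenvalue_eq_range hT]
  exact le_csSup (Set.finite_range _).bddAbove ⟨i, rfl⟩

theorem minEigenvalue_le_eigenvalues (hT : T.IsSymmetric) (i) :
    minEigenvalue T ≤ hT.eigenvalues rfl i := by
  rw [minEigenvalue, setOf_hasEigenvalue_eq_range hT]
  exact csInf_le (Set.finite_range _).bddBelow ⟨i, rfl⟩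

theorem exists_eigenvalues_eq_maxEigenvalue [Nontrivial E] (hT : T.IsSymmetric) :
    ∃ i, hT.eigenvalues rfl i = maxEigenvalue T := by
  rw [maxEigenvalue, setOf_hasEigenvalue_eq_range hT]
  have : Nonempty (Fin (Module.finrank ℂ E)) := ⟨⟨0, Module.finrank_pos⟩⟩
  exact (Set.range_nonempty _).csSup_mem (Set.finite_range _)

theorem apply_eigenvectorBasis_ofReal (hT : T.IsSymmetric) (i) :
    T (hT.eigenvectorBasis rfl i) =
      ((hT.eigenvalues rfl i : ℝ) : ℂ) • hT.eigenvectorBasis rfl i :=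
  hT.apply_eigenvectorBasis rfl i

theorem exists_eigenvector_maxEigenvalue [Nontrivial E] (hT : T.IsSymmetric) :
    ∃ v : E, ‖v‖ = 1 ∧ T v = (maxEigenvalue T : ℂ) • v := by
  obtain ⟨i, hi⟩ := exists_eigenvalues_eq_maxEigenvalue hT
  exact ⟨hT.eigenvectorBasis rfl i, (hT.eigenvectorBasis rfl).orthonormal.1 i,
    by rw [apply_eigenvectorBasis_ofReal, hi]⟩

theorem exists_eigenvalues_ne_zero (hT : T.IsSymmetric) (h0 : T ≠ 0) :
    ∃ i, hT.eigenvalues rfl i ≠ 0 := by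
  by_contra! h
  refine h0 ((hT.eigenvectorBasis rfl).toBasis.ext fun i => ?_)
  rw [OrthonormalBasis.coe_toBasis, apply_eigenvectorBasis_ofReal, h]
  simp

theorem sum_eigenvalues (hT : T.IsSymmetric) :
    ∑ i, hT.eigenvalues rfl i = (LinearMap.trace ℂ E T).re :=
  (hT.re_trace_eq_sum_eigenvalues rfl).symm

theorem exists_eigenvalues_pos (hT : T.IsSymmetric) (h0 : T ≠ 0)
    (htr : LinearMap.trace ℂ E T = 0) : ∃ i, 0 < hT.eigenvalues rfl i := by
  obtain ⟨i, hi⟩ := exists_eigenvalues_ne_zero hT h0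
  obtain ⟨j, -, hj⟩ := Finset.exists_pos_of_sum_zero_of_exists_nonzero
    (hT.eigenvalues rfl) (s := Finset.univ) (by rw [sum_eigenvalues, htr, Complex.zero_re])
    ⟨i, Finset.mem_univ _, hi⟩
  exact ⟨j, hj⟩

theorem exists_eigenvalues_neg (hT : T.IsSymmetric) (h0 : T ≠ 0)
    (htr : LinearMap.trace ℂ E T = 0) : ∃ i, hT.eigenvalues rfl i < 0 := by
  obtain ⟨i, hi⟩ := exists_eigenvalues_ne_zero hT h0
  obtain ⟨j, -, hj⟩ := Finset.exists_pos_of_sum_zero_of_exists_nonzero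
    (fun i => -hT.eigenvalues rfl i) (s := Finset.univ)
    (by rw [Finset.sum_neg_distrib, sum_eigenvalues, htr, Complex.zero_re, neg_zero])
    ⟨i, Finset.mem_univ _, neg_ne_zero.mpr hi⟩
  exact ⟨j, neg_pos.mp hj⟩

theorem eq_smul_one_of_le_minEigenvalue (hT : T.IsSymmetric) {d : ℝ} (hd : d ≤ minEigenvalue T)
    (htr : (LinearMap.trace ℂ E T).re = Module.finrank ℂ E * d) : T = (d : ℂ) • 1 := by
  have h := (Finset.sum_eq_sum_iff_of_le (s := Finset.univ) (f := fun _ => d)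
    (g := hT.eigenvalues rfl) fun i _ => hd.trans (minEigenvalue_le_eigenvalues hT i)).mp (by
      rw [sum_eigenvalues, htr]
      simp)
  refine (hT.eigenvectorBasis rfl).toBasis.ext fun i => ?_
  rw [OrthonormalBasis.coe_toBasis, apply_eigenvectorBasis_ofReal, ← h i (Finset.mem_univ _)]
  rfl

variable {K : Type*} [NormedAddCommGroup K] [InnerProductSpace ℂ K] [FiniteDimensional ℂ K]

/-- The basis of eigenvectors of `T ⊗ 1`. -/
def ampliationBasis (K : Type*) [NormedAddCommGroup K] [InnerProductSpace ℂ K]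
    [FiniteDimensional ℂ K] (hT : T.IsSymmetric) :
    OrthonormalBasis (Fin (Module.finrank ℂ E) × Fin (Module.finrank ℂ K)) ℂ (E ⊗[ℂ] K) :=
  (hT.eigenvectorBasis rfl).tensorProduct (stdOrthonormalBasis ℂ K)

theorem rTensor_ampliationBasis (hT : T.IsSymmetric)
    (ij : Fin (Module.finrank ℂ E) × Fin (Module.finrank ℂ K)) :
    LinearMap.rTensor K T (ampliationBasis K hT ij) =
      ((hT.eigenvalues rfl ij.1 : ℝ) : ℂ) • ampliationBasis K hT ij := by
  rw [ampliationBasis, OrthonormalBasis.tensorProduct_apply', LinearMap.rTensor_tmul,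
    apply_eigenvectorBasis_ofReal, TensorProduct.smul_tmul']

theorem re_inner_rTensor_le (hT : T.IsSymmetric) (w : E ⊗[ℂ] K) :
    (inner ℂ w (LinearMap.rTensor K T w)).re ≤ maxEigenvalue T * ‖w‖ ^ 2 :=
  re_inner_apply_le _ (rTensor_ampliationBasis hT)
    (fun ij => eigenvalues_le_maxEigenvalue hT ij.1) w

theorem le_re_inner_rTensor (hT : T.IsSymmetric) (w : E ⊗[ℂ] K) :
    minEigenvalue T * ‖w‖ ^ 2 ≤ (inner ℂ w (LinearMap.rTensor K T w)).re :=
  le_re_inner_apply _ (rTensor_ampliationBasis hT)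
    (fun ij => minEigenvalue_le_eigenvalues hT ij.1) w

theorem re_inner_apply_le_maxEigenvalue (hT : T.IsSymmetric) (w : E) :
    (inner ℂ w (T w)).re ≤ maxEigenvalue T * ‖w‖ ^ 2 :=
  re_inner_apply_le _ (apply_eigenvectorBasis_ofReal hT)
    (fun i => eigenvalues_le_maxEigenvalue hT i) w

end ExtremeEigenvalues

/-! ### The spectral inequalities for a pinching that kills `A ⊗ 1`. -/

section Pinching

variable {E : Type*} [NormedAddCommGroup E] [InnerProductSpace ℂ E] [FiniteDimensional ℂ E]
  {K : Type*} [NormedAddCommGroup K] [InnerProductSpace ℂ K] [FiniteDimensional ℂ K]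
  {n : ℕ}

section General

variable {F : Type*} [NormedAddCommGroup F] [InnerProductSpace ℂ F] [FiniteDimensional ℂ F]
  {P : Fin (n + 1) → Module.End ℂ F}

/-- The full sum over `n + 1` powers is zero and its term `k = 0` is `X`. This missing term is the
source of the summand `1` in the theorem. -/
theorem sum_clockUnitary_succ_conj_eq_neg (hP : ∀ a, IsStarProjection (P a))
    (hsum : ∑ a, P a = 1) {X : Module.End ℂ F} (hPX : ∀ a, P a * X * P a = 0) :
    ∑ k ∈ Finset.range n, clockUnitary P (k + 1) * X * star (clockUnitary P (k + 1)) = -X := by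
  have h := sum_clockUnitary_conj hP X
  rw [Finset.sum_range_succ', clockUnitary_zero hsum, star_one, one_mul, mul_one,
    Finset.sum_eq_zero fun a _ => hPX a, smul_zero] at h
  exact eq_neg_of_add_eq_zero_left h

theorem sum_clockUnitary_succ_conj_of_commute (hP : ∀ a, IsStarProjection (P a))
    (hsum : ∑ a, P a = 1) {D : Module.End ℂ F} (hPD : ∀ a, Commute (P a) D) :
    ∑ k ∈ Finset.range n, clockUnitary P (k + 1) * D * star (clockUnitary P (k + 1)) =
      ((n : ℝ) : ℂ) • D := by
  have h : ∀ k ∈ Finset.range n,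
      clockUnitary P (k + 1) * D * star (clockUnitary P (k + 1)) = D := fun k _ => by
    rw [(commute_clockUnitary hPD (k + 1)).eq, mul_assoc,
      clockUnitary_mul_star hP (orthogonal_of_sum_eq_one hP hsum) hsum, mul_one]
  rw [Finset.sum_congr rfl h, Finset.sum_const, Finset.card_range, Complex.ofReal_natCast,
    Nat.cast_smul_eq_nsmul]

theorem sum_clockUnitary_succ_mul_star (hP : ∀ a, IsStarProjection (P a))
    (hsum : ∑ a, P a = 1) :
    ∑ k ∈ Finset.range n, clockUnitary P (k + 1) * star (clockUnitary P (k + 1)) =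
      ((n : ℝ) : ℂ) • (1 : Module.End ℂ F) := by
  simpa using sum_clockUnitary_succ_conj_of_commute hP hsum (D := 1) fun _ => Commute.one_right _

end General

theorem card_filter_fst {ι κ : Type*} [Fintype ι] [Fintype κ] (p : ι → Prop) [DecidablePred p] :
    Finset.card {ij : ι × κ | p ij.1} = Fintype.card κ * Finset.card {i | p i} := by
  rw [Finset.card_filter, Fintype.sum_prod_type, Finset.card_filter, Finset.mul_sum]
  refine Finset.sum_congr rfl fun i _ => ?_
  by_cases h : p i <;> simp [h]

theorem sum_filter_fst {ι κ : Type*} [Fintype ι] [Fintype κ] (p : ι → Prop) [DecidablePred p]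
    (f : ι → ℝ) : ∑ ij : ι × κ with p ij.1, f ij.1 = Fintype.card κ * ∑ i with p i, f i := by
  rw [Finset.sum_filter, Fintype.sum_prod_type, Finset.sum_filter, Finset.mul_sum]
  simp

variable {P : Fin (n + 1) → Module.End ℂ (E ⊗[ℂ] K)} {A D : Module.End ℂ E}

theorem numPos_le_of_pinching [Nontrivial K] (hA : A.IsSymmetric)
    (hP : ∀ a, IsStarProjection (P a)) (hsum : ∑ a, P a = 1)
    (hPA : ∀ a, P a * LinearMap.rTensor K A * P a = 0) : numPos hA ≤ n * numNeg hA := by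
  have h := card_pos_le_of_sum_conj_eq_neg _ (rTensor_ampliationBasis (K := K) hA) _
    (sum_clockUnitary_succ_conj_eq_neg hP hsum hPA)
  rw [card_filter_fst fun i => 0 < hA.eigenvalues rfl i,
    card_filter_fst fun i => hA.eigenvalues rfl i < 0, mul_left_comm, Fintype.card_fin] at h
  -- Tensoring with `K` multiplies both counts by `dim K`, which cancels.
  exact Nat.le_of_mul_le_mul_left h Module.finrank_pos

theorem numNeg_le_of_pinching [Nontrivial K] (hA : A.IsSymmetric)
    (hP : ∀ a, IsStarProjection (P a)) (hsum : ∑ a, P a = 1)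
    (hPA : ∀ a, P a * LinearMap.rTensor K A * P a = 0) : numNeg hA ≤ n * numPos hA := by
  have h := card_pos_le_of_sum_conj_eq_neg (ampliationBasis K hA) (X := -LinearMap.rTensor K A)
    (μ := fun ij => -hA.eigenvalues rfl ij.1)
    (fun ij => by rw [LinearMap.neg_apply, rTensor_ampliationBasis, Complex.ofReal_neg, neg_smul])
    _ (sum_clockUnitary_succ_conj_eq_neg hP hsum fun a => by
      rw [mul_neg, neg_mul, hPA, neg_zero])
  simp only [Left.neg_pos_iff, Left.neg_neg_iff] at h
  rw [card_filter_fst fun i => 0 < hA.eigenvalues rfl i,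
    card_filter_fst fun i => hA.eigenvalues rfl i < 0, mul_left_comm, Fintype.card_fin] at h
  exact Nat.le_of_mul_le_mul_left h Module.finrank_pos

theorem sqSumPos_le_of_pinching [Nontrivial K] (hn : 1 ≤ n) (hA : A.IsSymmetric)
    (hP : ∀ a, IsStarProjection (P a)) (hsum : ∑ a, P a = 1)
    (hPA : ∀ a, P a * LinearMap.rTensor K A * P a = 0) : sqSumPos hA ≤ n * sqSumNeg hA := by
  have h := sum_sq_pos_le_of_annihilate _ (rTensor_ampliationBasis (K := K) hA) hn hP hsum hPA
  rw [sum_filter_fst (fun i => 0 < hA.eigenvalues rfl i) fun i => hA.eigenvalues rfl i ^ 2,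
    sum_filter_fst (fun i => hA.eigenvalues rfl i < 0) fun i => hA.eigenvalues rfl i ^ 2,
    mul_left_comm, Fintype.card_fin] at h
  exact le_of_mul_le_mul_left h (Nat.cast_pos.mpr Module.finrank_pos)

theorem sqSumNeg_le_of_pinching [Nontrivial K] (hn : 1 ≤ n) (hA : A.IsSymmetric)
    (hP : ∀ a, IsStarProjection (P a)) (hsum : ∑ a, P a = 1)
    (hPA : ∀ a, P a * LinearMap.rTensor K A * P a = 0) : sqSumNeg hA ≤ n * sqSumPos hA := by
  have h := sum_sq_pos_le_of_annihilate (ampliationBasis K hA) (X := -LinearMap.rTensor K A)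
    (μ := fun ij => -hA.eigenvalues rfl ij.1)
    (fun ij => by rw [LinearMap.neg_apply, rTensor_ampliationBasis, Complex.ofReal_neg, neg_smul])
    hn hP hsum fun a => by rw [mul_neg, neg_mul, hPA, neg_zero]
  simp only [Left.neg_pos_iff, Left.neg_neg_iff, neg_sq] at h
  rw [sum_filter_fst (fun i => 0 < hA.eigenvalues rfl i) fun i => hA.eigenvalues rfl i ^ 2,
    sum_filter_fst (fun i => hA.eigenvalues rfl i < 0) fun i => hA.eigenvalues rfl i ^ 2,
    mul_left_comm, Fintype.card_fin] at h
  exact le_of_mul_le_mul_left h (Nat.cast_pos.mpr Module.finrank_pos)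

theorem maxEigenvalue_le_of_pinching [Nontrivial E] [Nontrivial K] (hA : A.IsSymmetric)
    (hP : ∀ a, IsStarProjection (P a)) (hsum : ∑ a, P a = 1)
    (hPA : ∀ a, P a * LinearMap.rTensor K A * P a = 0) :
    maxEigenvalue A ≤ n * (-minEigenvalue A) := by
  obtain ⟨v, hv, hAv⟩ := exists_eigenvector_maxEigenvalue hA
  obtain ⟨f, hf⟩ := exists_norm_eq K zero_le_one
  exact le_mul_of_sum_conj_eq_neg _ _ (sum_clockUnitary_succ_mul_star hP hsum)
    (sum_clockUnitary_succ_conj_eq_neg hP hsum hPA) (le_re_inner_rTensor hA)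
    (v := v ⊗ₜ f) (by rw [TensorProduct.norm_tmul, hv, hf, mul_one])
    (by rw [re_inner_rTensor_tmul _ _ hf, re_inner_apply_of_eigenvector hv hAv])

theorem degree_le_of_pinching [Nontrivial K] (hDA : (D + A).IsSymmetric)
    (hP : ∀ a, IsStarProjection (P a)) (hsum : ∑ a, P a = 1)
    (hPA : ∀ a, P a * LinearMap.rTensor K A * P a = 0)
    (hPD : ∀ a, Commute (P a) (LinearMap.rTensor K D)) {v : E} (hv : ‖v‖ = 1) {d : ℝ}
    (hAv : (inner ℂ v (A v)).re = d) (hDv : (inner ℂ v (D v)).re = d) :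
    d ≤ n * (d - minEigenvalue (D + A)) := by
  obtain ⟨f, hf⟩ := exists_norm_eq K zero_le_one
  refine degree_le_of_sum_conj_eq_neg _ _ (sum_clockUnitary_succ_mul_star hP hsum)
    (sum_clockUnitary_succ_conj_eq_neg hP hsum hPA)
    (sum_clockUnitary_succ_conj_of_commute hP hsum hPD) (fun w => ?_)
    (v := v ⊗ₜ f) (by rw [TensorProduct.norm_tmul, hv, hf, mul_one])
    (by rw [re_inner_rTensor_tmul _ _ hf, hAv]) (by rw [re_inner_rTensor_tmul _ _ hf, hDv])
  rw [← LinearMap.rTensor_add]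
  exact le_re_inner_rTensor hDA w

theorem signless_le_of_pinching [Nontrivial E] [Nontrivial K] (hn : 1 ≤ n) (hA : A.IsSymmetric)
    (hD : D.IsSymmetric) (hP : ∀ a, IsStarProjection (P a)) (hsum : ∑ a, P a = 1)
    (hPA : ∀ a, P a * LinearMap.rTensor K A * P a = 0)
    (hPD : ∀ a, Commute (P a) (LinearMap.rTensor K D)) :
    n * maxEigenvalue (D + A) ≤ n * maxEigenvalue (D - A) + (n - 1) * maxEigenvalue A := by
  obtain ⟨v, hv, hQv⟩ := exists_eigenvector_maxEigenvalue (hD.add hA)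
  obtain ⟨f, hf⟩ := exists_norm_eq K zero_le_one
  refine signless_le_of_sum_conj_eq_neg _ _ (by exact_mod_cast hn)
    (sum_clockUnitary_succ_mul_star hP hsum)
    (sum_clockUnitary_succ_conj_eq_neg hP hsum hPA)
    (sum_clockUnitary_succ_conj_of_commute hP hsum hPD) (fun w => ?_) (re_inner_rTensor_le hA)
    (v := v ⊗ₜ f) (by rw [TensorProduct.norm_tmul, hv, hf, mul_one]) ?_
  · rw [← LinearMap.rTensor_sub]
    exact re_inner_rTensor_le (hD.sub hA) w
  · rw [← LinearMap.rTensor_add, re_inner_rTensor_tmul _ _ hf, re_inner_apply_of_eigenvector hv hQv]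

end Pinching

/-! ### Colourings as projections on `L²(M) ⊗ L²(N)`. -/

namespace FaithfulState

section Coloring

variable {M N : Type*} [CStarAlgebra M] [CStarAlgebra N] (ψ : FaithfulState M)
  (τ : FaithfulState N)

theorem nontrivial_L2 : Nontrivial ψ.L2 :=
  ⟨ψ.toL2 1, 0, fun h => by simpa [h] using ψ.norm_toL2_one⟩

/-- The representation of `M ⊗ N` on `L²(M) ⊗ L²(N)`. -/
def tensorReg : M ⊗[ℂ] N →ₐ[ℂ] Module.End ℂ (ψ.L2 ⊗[ℂ] τ.L2) :=
  Module.endTensorEndAlgHom.comp (Algebra.TensorProduct.map ψ.leftReg τ.leftReg)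

theorem tensorReg_tmul (x : M) (y : N) :
    ψ.tensorReg τ (x ⊗ₜ y) = TensorProduct.map (ψ.leftReg x) (τ.leftReg y) := by
  rfl

theorem commute_tensorReg_rTensor {D : Module.End ℂ ψ.L2} (hD : ∀ x, Commute (ψ.leftReg x) D)
    (t : M ⊗[ℂ] N) : Commute (ψ.tensorReg τ t) (LinearMap.rTensor τ.L2 D) := by
  induction t with
  | zero => rw [map_zero]; exact Commute.zero_left _
  | add s t hs ht => rw [map_add]; exact hs.add_left ht
  | tmul x y =>
    rw [tensorReg_tmul, commute_iff_eq, Module.End.mul_eq_comp, Module.End.mul_eq_comp,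
      LinearMap.map_comp_rTensor, LinearMap.rTensor_comp_map]
    congr 1
    exact hD x

theorem tensorReg_star [FiniteDimensional ℂ M] [FiniteDimensional ℂ N] (t : M ⊗[ℂ] N) :
    ψ.tensorReg τ (star t) = star (ψ.tensorReg τ t) := by
  induction t with
  | zero => rw [star_zero, map_zero, LinearMap.star_eq_adjoint, map_zero]
  | add s t hs ht =>
    rw [star_add, map_add, map_add, hs, ht, LinearMap.star_eq_adjoint, LinearMap.star_eq_adjoint,
      LinearMap.star_eq_adjoint, map_add]
  | tmul x y =>
    rw [TensorProduct.star_tmul, tensorReg_tmul, tensorReg_tmul, ← star_leftReg, ← star_leftReg,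
      LinearMap.star_eq_adjoint, LinearMap.star_eq_adjoint, LinearMap.star_eq_adjoint,
      TensorProduct.adjoint_map]

/-- The colouring condition lives in `B(L²(M)) ⊗ N`; representing `N` on `L²(N)` carries it to
operators on a Hilbert space. -/
theorem tensorReg_annihilate {X : Module.End ℂ ψ.L2} {t : M ⊗[ℂ] N}
    (h : Algebra.TensorProduct.map ψ.leftReg (AlgHom.id ℂ N) t * (X ⊗ₜ[ℂ] (1 : N)) *
      Algebra.TensorProduct.map ψ.leftReg (AlgHom.id ℂ N) t = 0) :
    ψ.tensorReg τ t * LinearMap.rTensor τ.L2 X * ψ.tensorReg τ t = 0 := by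
  let ρ : Module.End ℂ ψ.L2 ⊗[ℂ] N →ₐ[ℂ] Module.End ℂ (ψ.L2 ⊗[ℂ] τ.L2) :=
    Module.endTensorEndAlgHom.comp (Algebra.TensorProduct.map (AlgHom.id ℂ _) τ.leftReg)
  have h1 : ∀ t, ρ (Algebra.TensorProduct.map ψ.leftReg (AlgHom.id ℂ N) t) =
      ψ.tensorReg τ t := by
    intro t
    induction t with
    | zero => simp only [map_zero]
    | add s t hs ht => simp only [map_add, hs, ht]
    | tmul x y => rfl
  have h2 : ρ (X ⊗ₜ 1) = LinearMap.rTensor τ.L2 X := by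
    change TensorProduct.map X (τ.leftReg 1) = _
    rw [_root_.map_one]
    rfl
  have h3 := congrArg ρ h
  rwa [map_mul, map_mul, map_zero, h1, h2] at h3

end Coloring

/-! ### Chromatic numbers and the two denominators that involve `Q`. -/

section Bounds

variable {M : Type*} [CStarAlgebra M]

theorem quantumChromaticNumber_le_classicalChromaticNumber (ψ : FaithfulState M)
    (S : Submodule ℂ (Module.End ℂ ψ.L2)) :
    ψ.quantumChromaticNumber S ≤ ψ.classicalChromaticNumber S := by
  refine le_iInf₂ fun c hc => iInf₂_le c ?_
  obtain ⟨N, _, τ, P, hN, hτ, hP⟩ := hc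
  exact ⟨N, _, τ, P, Module.finite_of_finrank_eq_succ hN, hτ, hP⟩

theorem degree_eq_inner (ψ : FaithfulState M) (A : Module.End ℂ ψ.L2) :
    inner ℂ (ψ.toL2 1) (ψ.degree A (ψ.toL2 1)) = ψ.toFun (ψ.onAlgebra A 1) := by
  rw [degree_toL2, ψ.inner_def, star_one, one_mul, one_mul]

theorem adjacency_eq_inner (ψ : FaithfulState M) (A : Module.End ℂ ψ.L2) :
    inner ℂ (ψ.toL2 1) (A (ψ.toL2 1)) = ψ.toFun (ψ.onAlgebra A 1) := by
  rw [apply_toL2, ψ.inner_def, star_one, one_mul]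

/-- Colour numbers are natural, so the bound may be rounded up and passed to the infimum in `ℕ∞`;
this includes the value `⊤`. -/
theorem le_quantumChromaticNumber {ψ : FaithfulState M}
    {S : Submodule ℂ (Module.End ℂ ψ.L2)} {r : ℝ}
    (h : ∀ c : ℕ, ψ.QuantumColorable S c → r ≤ c) :
    (r : EReal) ≤ ((ψ.quantumChromaticNumber S : ℝ≥0∞) : EReal) := by
  have h1 : ((⌈r⌉₊ : ℕ) : ℕ∞) ≤ ψ.quantumChromaticNumber S :=
    le_iInf₂ fun c hc => Nat.cast_le.mpr (Nat.ceil_le.mpr (h c hc))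
  have h2 : (r : EReal) ≤ ((⌈r⌉₊ : ℝ) : EReal) := EReal.coe_le_coe_iff.mpr (Nat.le_ceil r)
  refine h2.trans ?_
  have h3 : (((⌈r⌉₊ : ℕ∞) : ℝ≥0∞) : EReal) ≤ ((ψ.quantumChromaticNumber S : ℝ≥0∞) : EReal) :=
    EReal.coe_ennreal_le_coe_ennreal_iff.mpr (ENat.toENNReal_le.mpr h1)
  have h4 : (((⌈r⌉₊ : ℕ∞) : ℝ≥0∞) : EReal) = ((⌈r⌉₊ : ℝ) : EReal) := by
    rw [ENat.toENNReal_coe, ← ENNReal.coe_natCast, EReal.coe_nnreal_eq_coe_real,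
      NNReal.coe_natCast]
  rwa [h4] at h3

variable [FiniteDimensional ℂ M] {ψ : FaithfulState M} {δ : ℝ} {A : Module.End ℂ ψ.L2}

/-- The eigenvalues of `Q` have mean `d = ψ(A 1)`, as `A` is traceless. If none lies below `d`, then
`Q = d`. Evaluating at `1` gives `2 A 1 = d 1`, so `2 d = d`; hence `d = 0` and `A 1 = 0`, whence `D
= 0` and `A = Q = 0`. -/
theorem minEigenvalue_signlessLaplacian_lt (hψ : ψ.IsTracial) (hδ : ψ.IsDeltaForm δ)
    (hA : ψ.IsQuantumAdjacency δ A) (hirr : ψ.IsIrreflexive A) (h0 : A ≠ 0) :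
    minEigenvalue (ψ.signlessLaplacian A) < (ψ.toFun (ψ.onAlgebra A 1)).re := by
  by_contra! hle
  have hQ := eq_smul_one_of_le_minEigenvalue
    (T := ψ.signlessLaplacian A) ((degree_isSymmetric hψ hA).add hA.selfAdjoint) hle (by
      rw [signlessLaplacian, map_add, trace_eq_zero hψ hirr, add_zero, trace_degree hψ hδ,
        ← Complex.ofReal_natCast, Complex.re_ofReal_mul]
      rfl)
  set d := (ψ.toFun (ψ.onAlgebra A 1)).re with hd
  have hx : ∀ x : M, x * ψ.onAlgebra A 1 + ψ.onAlgebra A x = (d : ℂ) • x := fun x =>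
    ψ.toL2.injective (LinearMap.congr_fun hQ (ψ.toL2 x))
  have h1 := congrArg (fun y => (ψ.toFun y).re) (hx 1)
  simp only [one_mul, map_add, map_smul, ψ.map_one, Complex.add_re, smul_eq_mul, mul_one,
    Complex.ofReal_re, ← hd] at h1
  have hd0 : d = 0 := by linarith
  have h2 := hx 1
  rw [hd0, Complex.ofReal_zero, zero_smul, one_mul, ← two_smul ℂ,
    smul_eq_zero_iff_right two_ne_zero] at h2
  refine h0 (ψ.onAlgebra_injective (LinearMap.ext fun x => ?_))
  have h3 := hx x
  rw [h2, mul_zero, zero_add, hd0, Complex.ofReal_zero, zero_smul] at h3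
  exact h3

/-- Left multiplications by an orthonormal basis containing `1`, with `1` omitted, send `A` to `-A`
and scale `D` by `r = dim M - 1`. The signless inequality then reads `λ ≤ r (λ - γ + θ)` for the top
eigenvalues, and `λ > 0`. -/
theorem pos_maxEigenvalue_sub_add (hψ : ψ.IsTracial) (hδ : ψ.IsDeltaForm δ)
    (hA : ψ.IsQuantumAdjacency δ A) (hirr : ψ.IsIrreflexive A) (h0 : A ≠ 0) :
    0 < maxEigenvalue A - maxEigenvalue (ψ.signlessLaplacian A) +
      maxEigenvalue (ψ.laplacian A) := by
  classical
  have := ψ.nontrivial_L2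
  obtain ⟨i, hi⟩ := exists_eigenvalues_pos hA.selfAdjoint h0 (trace_eq_zero hψ hirr)
  obtain ⟨j, hj⟩ := exists_eigenvalues_neg hA.selfAdjoint h0 (trace_eq_zero hψ hirr)
  have hpos : 0 < maxEigenvalue A := hi.trans_le (eigenvalues_le_maxEigenvalue _ i)
  -- Eigenvalues of both signs force dimension at least two; this is the condition `1 ≤ r` of the
  -- signless inequality.
  have hdim : 2 ≤ Module.finrank ℂ M := by
    have hij : i ≠ j := by rintro rfl; exact lt_asymm hi hj
    have : Nontrivial (Fin (Module.finrank ℂ M)) := ⟨i, j, hij⟩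
    exact Fin.nontrivial_iff_two_le.mp this
  have hv : Orthonormal ℂ ((↑) : ({ψ.toL2 1} : Set ψ.L2) → ψ.L2) := by
    rw [orthonormal_subtype_iff_ite]
    rintro v rfl w rfl
    rw [if_pos rfl, inner_self_eq_norm_sq_to_K, ψ.norm_toL2_one]
    simp
  obtain ⟨u, b, hu, hb⟩ := hv.exists_orthonormalBasis_extension
  let k₀ : u := ⟨ψ.toL2 1, hu rfl⟩
  have hk₀ : ψ.leftReg (ψ.basisElem b k₀) = 1 := by
    have : ψ.basisElem b k₀ = 1 := by
      rw [basisElem, hb]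
      rfl
    rw [this, _root_.map_one]
  have herase : ∀ X : Module.End ℂ ψ.L2, ∑ k ∈ Finset.univ.erase k₀,
      ψ.leftReg (ψ.basisElem b k) * X * star (ψ.leftReg (ψ.basisElem b k)) =
      ∑ k, ψ.leftReg (ψ.basisElem b k) * X * star (ψ.leftReg (ψ.basisElem b k)) - X := by
    intro X
    rw [← Finset.add_sum_erase Finset.univ _ (Finset.mem_univ k₀), hk₀, star_one, one_mul,
      mul_one, add_sub_cancel_left]
  have hD : ∀ X : Module.End ℂ ψ.L2, (∀ x, Commute (ψ.leftReg x) X) →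
      ∑ k ∈ Finset.univ.erase k₀,
        ψ.leftReg (ψ.basisElem b k) * X * star (ψ.leftReg (ψ.basisElem b k)) =
      (((Module.finrank ℂ M : ℝ) - 1 : ℝ) : ℂ) • X := by
    intro X hX
    rw [herase]
    simp only [(hX _).eq, mul_assoc]
    rw [← Finset.mul_sum, sum_leftReg_mul_star hψ hδ, ← finrank_eq_sq hψ hδ, mul_smul_comm,
      mul_one]
    push_cast
    rw [sub_smul, one_smul]
  obtain ⟨v, hv, hQv⟩ := exists_eigenvector_maxEigenvalue
    (T := ψ.signlessLaplacian A) ((degree_isSymmetric hψ hA).add hA.selfAdjoint)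
  have hdim' : (2 : ℝ) ≤ Module.finrank ℂ M := by exact_mod_cast hdim
  have key := signless_le_of_sum_conj_eq_neg (X := A) (D := ψ.degree A) (Finset.univ.erase k₀)
    (fun k => ψ.leftReg (ψ.basisElem b k)) (r := (Module.finrank ℂ M : ℝ) - 1) (by linarith)
    (by simpa using hD 1 fun _ => Commute.one_right _)
    (by rw [herase, sum_leftReg_conj hψ hA hirr, zero_sub])
    (hD _ (ψ.degree_commute_leftReg A))
    (re_inner_apply_le_maxEigenvalue ((degree_isSymmetric hψ hA).sub hA.selfAdjoint))
    (re_inner_apply_le_maxEigenvalue hA.selfAdjoint) hv (re_inner_apply_of_eigenvector hv hQv)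
  change _ ≤ _ * maxEigenvalue (ψ.laplacian A) + _ at key
  have h1 : 0 < ((Module.finrank ℂ M : ℝ) - 1) * (maxEigenvalue A -
      maxEigenvalue (ψ.signlessLaplacian A) + maxEigenvalue (ψ.laplacian A)) := by
    linarith
  exact pos_of_mul_pos_right h1 (by linarith)

end Bounds

end FaithfulState

theorem sqSumPos_pos {E : Type*} [NormedAddCommGroup E] [InnerProductSpace ℂ E]
    [FiniteDimensional ℂ E] {T : Module.End ℂ E} (hT : T.IsSymmetric)
    (h : ∃ i, 0 < hT.eigenvalues rfl i) : 0 < sqSumPos hT := by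
  obtain ⟨i, hi⟩ := h
  exact Finset.sum_pos' (fun _ _ => sq_nonneg _) ⟨i, by simpa using hi, by positivity⟩

theorem sqSumNeg_pos {E : Type*} [NormedAddCommGroup E] [InnerProductSpace ℂ E]
    [FiniteDimensional ℂ E] {T : Module.End ℂ E} (hT : T.IsSymmetric)
    (h : ∃ i, hT.eigenvalues rfl i < 0) : 0 < sqSumNeg hT := by
  obtain ⟨i, hi⟩ := h
  exact Finset.sum_pos' (fun _ _ => sq_nonneg _) ⟨i, by simpa using hi, by nlinarith⟩

theorem numPos_pos {E : Type*} [NormedAddCommGroup E] [InnerProductSpace ℂ E]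
    [FiniteDimensional ℂ E] {T : Module.End ℂ E} (hT : T.IsSymmetric)
    (h : ∃ i, 0 < hT.eigenvalues rfl i) : 0 < numPos hT := by
  obtain ⟨i, hi⟩ := h
  exact Finset.card_pos.mpr ⟨i, by simpa using hi⟩

theorem numNeg_pos {E : Type*} [NormedAddCommGroup E] [InnerProductSpace ℂ E]
    [FiniteDimensional ℂ E] {T : Module.End ℂ E} (hT : T.IsSymmetric)
    (h : ∃ i, hT.eigenvalues rfl i < 0) : 0 < numNeg hT := by
  obtain ⟨i, hi⟩ := h
  exact Finset.card_pos.mpr ⟨i, by simpa using hi⟩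

namespace FaithfulState

variable {M N : Type*} [CStarAlgebra M] [CStarAlgebra N] {ψ : FaithfulState M}
  {S : Submodule ℂ (Module.End ℂ ψ.L2)} {c : ℕ} {P : Fin c → M ⊗[ℂ] N}

theorem IsColoring.sum_tensorReg (hP : ψ.IsColoring S N P) (τ : FaithfulState N) :
    ∑ a, ψ.tensorReg τ (P a) = 1 := by
  rw [← map_sum, hP.sum_eq_one, _root_.map_one]
theorem IsColoring.isStarProjection_tensorReg [FiniteDimensional ℂ M]
    [FiniteDimensional ℂ N] (hP : ψ.IsColoring S N P) (τ : FaithfulState N)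
    (a : Fin c) : IsStarProjection (ψ.tensorReg τ (P a)) where
  isIdempotentElem := by
    rw [IsIdempotentElem, ← map_mul, (hP.proj a).isIdempotentElem.eq]
  isSelfAdjoint := by
    rw [isSelfAdjoint_iff, ← tensorReg_star, (hP.proj a).isSelfAdjoint.star_eq]

theorem IsColoring.pos (hP : ψ.IsColoring S N P) (τ : FaithfulState N) : 1 ≤ c := by
  have := ψ.nontrivial_L2
  have := τ.nontrivial_L2
  rcases Nat.eq_zero_or_pos c with rfl | h
  · have h1 := hP.sum_tensorReg τ
    rw [Fin.sum_univ_zero] at h1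
    have h2 := LinearMap.congr_fun h1 (ψ.toL2 1 ⊗ₜ τ.toL2 1)
    have h3 := TensorProduct.norm_tmul (𝕜 := ℂ) (ψ.toL2 1) (τ.toL2 1)
    rw [ψ.norm_toL2_one, τ.norm_toL2_one, mul_one] at h3
    rw [LinearMap.zero_apply, Module.End.one_apply] at h2
    rw [← h2, norm_zero] at h3
    exact absurd h3 zero_ne_one
  · exact h

/-- A single colour class must be the identity, so the annihilation condition reads `X ⊗ 1 = 0`. -/
theorem IsColoring.eq_zero_of_mem {P : Fin 1 → M ⊗[ℂ] N} (hP : ψ.IsColoring S N P)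
    (τ : FaithfulState N) {X : Module.End ℂ ψ.L2} (hX : X ∈ S) : X = 0 := by
  have h := ψ.tensorReg_annihilate τ (hP.annihilate X hX 0)
  have h1 := hP.sum_tensorReg τ
  rw [Fin.sum_univ_one] at h1
  rw [h1, one_mul, mul_one] at h
  ext x
  have h2 := LinearMap.congr_fun h (x ⊗ₜ τ.toL2 1)
  have h3 := TensorProduct.norm_tmul (𝕜 := ℂ) (X x) (τ.toL2 1)
  rw [LinearMap.rTensor_tmul, LinearMap.zero_apply] at h2
  rw [h2, norm_zero, τ.norm_toL2_one, mul_one] at h3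
  exact norm_eq_zero.mp h3.symm

end FaithfulState

end

/-! ### Assembly of the bounds. -/

theorem theorem1p1 {M : Type*} [CStarAlgebra M] [FiniteDimensional ℂ M]
    (ψ : FaithfulState M) (hψ : ψ.IsTracial) (δ : ℝ) (hδ : ψ.IsDeltaForm δ)
    (A : Module.End ℂ ψ.L2) (hA : ψ.IsQuantumAdjacency δ A) (hirr : ψ.IsIrreflexive A)
    (S : Submodule ℂ (Module.End ℂ ψ.L2)) (hS : S = ψ.edgeSpace δ A)
    (lamMax lamMin gamMax gamMin thMax sP sN nP nN dimS dimM : ℝ)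
    (hlamMax : lamMax = maxEigenvalue A) (hlamMin : lamMin = minEigenvalue A)
    (hgamMax : gamMax = maxEigenvalue (ψ.signlessLaplacian A))
    (hgamMin : gamMin = minEigenvalue (ψ.signlessLaplacian A))
    (hthMax : thMax = maxEigenvalue (ψ.laplacian A))
    (hsP : sP = sqSumPos hA.selfAdjoint) (hsN : sN = sqSumNeg hA.selfAdjoint)
    (hnP : nP = numPos hA.selfAdjoint) (hnN : nN = numNeg hA.selfAdjoint)
    (hdimS : dimS = Module.finrank ℂ S) (hdimM : dimM = Module.finrank ℂ M) :
    -- for a nonzero edge space all denominators below are positive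
    (S ≠ ⊥ → 0 < |lamMin| ∧ 0 < dimS - dimM * gamMin ∧ 0 < sP ∧ 0 < sN ∧ 0 < nP ∧ 0 < nN ∧
      0 < lamMax - gamMax + thMax) ∧
    -- for `S = ⊥` all quotients are `0 / 0 = 0`
    ((1 + (lamMax / |lamMin| ⊔ dimS / (dimS - dimM * gamMin) ⊔ sP / sN ⊔ sN / sP ⊔
        nP / nN ⊔ nN / nP ⊔ lamMax / (lamMax - gamMax + thMax)) : ℝ) : EReal) ≤
      ((ψ.quantumChromaticNumber S : ℝ≥0∞) : EReal) ∧
    ψ.quantumChromaticNumber S ≤ ψ.classicalChromaticNumber S := by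
  have := ψ.nontrivial_L2
  have hsym := hA.selfAdjoint
  have hdim : dimS = dimM * (ψ.toFun (ψ.onAlgebra A 1)).re := by
    rw [hdimS, hdimM, hS, ψ.finrank_edgeSpace hψ hδ hA]
  have hdimM0 : 0 < dimM := by
    rw [hdimM]
    exact_mod_cast (Module.finrank_pos (R := ℂ) (M := ψ.L2))
  have hbot : S = ⊥ ↔ A = 0 := by rw [hS, ψ.edgeSpace_eq_bot_iff hδ hA]
  have hpos : A ≠ 0 → lamMin < 0 ∧ 0 < dimS - dimM * gamMin ∧ 0 < sP ∧ 0 < sN ∧ 0 < nP ∧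
      0 < nN ∧ 0 < lamMax - gamMax + thMax := by
    intro h0
    have htr := ψ.trace_eq_zero hψ hirr
    have hp := exists_eigenvalues_pos hsym h0 htr
    have hn := exists_eigenvalues_neg hsym h0 htr
    refine ⟨?_, ?_, ?_, ?_, ?_, ?_, ?_⟩
    · obtain ⟨i, hi⟩ := hn
      rw [hlamMin]
      exact (minEigenvalue_le_eigenvalues hsym i).trans_lt hi
    · rw [hdim, hgamMin, ← mul_sub]
      exact mul_pos hdimM0
        (sub_pos.mpr (ψ.minEigenvalue_signlessLaplacian_lt hψ hδ hA hirr h0))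
    · rw [hsP]; exact sqSumPos_pos hsym hp
    · rw [hsN]; exact sqSumNeg_pos hsym hn
    · rw [hnP]; exact_mod_cast numPos_pos hsym hp
    · rw [hnN]; exact_mod_cast numNeg_pos hsym hn
    · rw [hlamMax, hgamMax, hthMax]
      exact ψ.pos_maxEigenvalue_sub_add hψ hδ hA hirr h0
  refine ⟨fun hS0 => ?_, ?_, ψ.quantumChromaticNumber_le_classicalChromaticNumber S⟩
  · obtain ⟨h1, h2⟩ := hpos (mt hbot.mpr hS0)
    exact ⟨abs_pos.mpr h1.ne, h2⟩
  refine ψ.le_quantumChromaticNumber fun c hc => ?_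
  obtain ⟨N, _, τ, P, _, -, hP⟩ := hc
  have := τ.nontrivial_L2
  have hc1 := hP.pos τ
  -- For `A = 0` every numerator vanishes, so all quotients are `0` and the claim is `1 ≤ c`.
  by_cases h0 : A = 0
  · have heig : ∀ i, hsym.eigenvalues rfl i = 0 := by
      intro i
      have h1 := LinearMap.congr_fun h0 (hsym.eigenvectorBasis rfl i)
      rw [apply_eigenvectorBasis_ofReal, LinearMap.zero_apply, smul_eq_zero] at h1
      exact Complex.ofReal_eq_zero.mp
        (h1.resolve_right ((hsym.eigenvectorBasis rfl).orthonormal.ne_zero i))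
    have h1 : lamMax = 0 := by
      obtain ⟨i, hi⟩ := exists_eigenvalues_eq_maxEigenvalue hsym
      rw [hlamMax, ← hi, heig]
    have h2 : dimS = 0 := by
      rw [hdimS, hbot.mpr h0, finrank_bot, Nat.cast_zero]
    have h3 : sP = 0 := by simp [hsP, sqSumPos, heig]
    have h4 : sN = 0 := by simp [hsN, sqSumNeg, heig]
    have h5 : nP = 0 := by simp [hnP, numPos, heig]
    have h6 : nN = 0 := by simp [hnN, numNeg, heig]
    rw [h1, h2, h3, h4, h5, h6]
    simpa using hc1
  obtain ⟨h1, h2, h3, h4, h5, h6, h7⟩ := hpos h0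
  have hAS : A ∈ S := hS ▸ ψ.adjacency_mem_edgeSpace hδ hA
  obtain ⟨n, rfl⟩ : ∃ n, c = n + 1 := ⟨c - 1, by omega⟩
  have hn : 1 ≤ n := by
    rcases Nat.eq_zero_or_pos n with rfl | h
    · exact absurd (hP.eq_zero_of_mem τ hAS) h0
    · exact h
  have hQ := hP.isStarProjection_tensorReg τ
  have hsum := hP.sum_tensorReg τ
  have hQA := fun a => ψ.tensorReg_annihilate τ (hP.annihilate A hAS a)
  have hQD := fun a => ψ.commute_tensorReg_rTensor τ (ψ.degree_commute_leftReg A) (P a)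
  have hD := ψ.degree_isSymmetric hψ hA
  have key : lamMax / |lamMin| ⊔ dimS / (dimS - dimM * gamMin) ⊔ sP / sN ⊔ sN / sP ⊔
      nP / nN ⊔ nN / nP ⊔ lamMax / (lamMax - gamMax + thMax) ≤ n := by
    refine sup_le (sup_le (sup_le (sup_le (sup_le (sup_le ?_ ?_) ?_) ?_) ?_) ?_) ?_
    · rw [abs_of_neg h1, div_le_iff₀ (neg_pos.mpr h1), hlamMax, hlamMin]
      exact maxEigenvalue_le_of_pinching hsym hQ hsum hQA
    -- At the unit vector `1` both `A` and `D` have expectation `ψ(A 1)`; the factor `dim M` turns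
    -- this into `dim S`.
    · have h := degree_le_of_pinching (hD.add hsym) hQ hsum hQA hQD ψ.norm_toL2_one
        (congrArg Complex.re (ψ.adjacency_eq_inner A)) (congrArg Complex.re (ψ.degree_eq_inner A))
      rw [div_le_iff₀ h2, hdim, hgamMin, ← mul_sub, mul_left_comm]
      exact mul_le_mul_of_nonneg_left h hdimM0.le
    · rw [div_le_iff₀ h4, hsP, hsN]
      exact sqSumPos_le_of_pinching hn hsym hQ hsum hQA
    · rw [div_le_iff₀ h3, hsP, hsN]
      exact sqSumNeg_le_of_pinching hn hsym hQ hsum hQA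
    · rw [div_le_iff₀ h6, hnP, hnN]
      exact_mod_cast numPos_le_of_pinching hsym hQ hsum hQA
    · rw [div_le_iff₀ h5, hnP, hnN]
      exact_mod_cast numNeg_le_of_pinching hsym hQ hsum hQA
    · have h := signless_le_of_pinching hn hsym hD hQ hsum hQA hQD
      rw [div_le_iff₀ h7, hlamMax, hgamMax, hthMax, FaithfulState.signlessLaplacian,
        FaithfulState.laplacian]
      linarith
  push_cast
  linarith
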